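/- **Setting.** Let $\Delta$ be a simple graph (finite or infinite) and let $\mathbb P$ be a projective geometry, given by points and lines: two distinct points lie on a unique line, every line has at least three points, and the Veblen–Young axiom holds; the dimension is arbitrary. Flats are the line-closed sets, and a hyperplane of a flat is a maximal proper subflat. Let $\mathbb P'$ be a hyperplane of $\mathbb P$, let $\mathbf z':E(\Delta)\to\mathbb P'$ be a projective representation of the graphic matroid $G(\Delta)$ (an edge set contains no circle if and only if $\mathbf z'$ maps it injectively to an independent point set), and let $\hat e_0$ be a point of $\mathbb P\setminus\mathbb P'$. The *edge line* of $e\in E(\Delta)$ is the line through $\mathbf z'(e)$ and $\hat e_0$; let $\hat E(\Delta,\hat e_0)$ be the union of all edge lines. Every point of $\hat E(\Delta,\hat e_0)\setminus\{\hat e_0\}$ lies on exactly one edge line; if it is the edge line of $e$, we say that the point *projects* to $e$. Let $\Omega=\Omega_0(\hat E(\Delta,\hat e_0))$ be the following graph with a class of circles (edge sets of simple closed paths, of length at least $2$). Its nodes are those of $\Delta$; its edges are the points of $\hat E(\Delta,\hat e_0)\setminus\{\hat e_0\}$, each having the same endpoints as the edge of $\Delta$ to which it projects; a circle $C$ is *balanced*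 if the flat spanned by $C$ does not contain $\hat e_0$. A *biased graph* is a graph with a class of balanced circles such that no theta subgraph contains exactly two balanced circles. A *biased expansion* of $\Delta$ is a biased graph with a surjective projection $p$ onto $\Delta$ that is the identity on nodes and is such that, for every circle $C=\{e_1,\dots,e_l\}$ of $\Delta$, every $i$, and every choice of $\tilde e_j\in p^{-1}(e_j)$ for $j\ne i$, there is a unique $\tilde e_i\in p^{-1}(e_i)$ for which $\{\tilde e_1,\dots,\tilde e_l\}$ is a balanced circle. For a skew field $\mathbb F$ with additive group $\mathbb F^+$, $\langle\mathbb F^+\Delta\rangle$ is the biased graph of the group expansion $\mathbb F^+\Delta$: its nodes are those of $\Delta$, its edge set is $\mathbb F\times E(\Delta)$, the edge $(g,e)$ has the endpoints of $e$ and has gain $g$ in a fixed reference direction of $e$ and $-g$ in the opposite direction, and a circle is balanced if its total gain, taken in the direction of a traversal of it, is $0$. **Proposition.** (I) $\Omega$, with the above projection to $\Delta$, is a biased expansion of $\Delta$ (in particular, it is a biased graph). (II) Suppose that $\mathbb P$ has coordinates in a skew field $\mathbb F$, that is, it is isomorphic to the projective geometry of a left vector space over $\mathbb F$. (a) If $\Delta$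 is finite and $\mathbb P'\neq\varnothing$, then $\mathbf z'$ represents $\Delta$ in an affine part of $\mathbb P'$ (that is, $\mathbf z'(E(\Delta))\subseteq\mathbb P'\setminus h'$ for some hyperplane $h'$ of $\mathbb P'$) if and only if $\Delta$ is $\#\mathbb F$-colorable. (b) If $\mathbf z'$ represents $\Delta$ in an affine part of $\mathbb P'$, or if $\Delta$ is $\#\mathbb F$-colorable, then $\Omega=\langle\mathbb F^+\Delta\rangle$ up to renaming of edges: for every choice of reference directions of the edges of $\Delta$ there is an isomorphism of biased graphs that is the identity on nodes, commutes with the projections to $\Delta$, and preserves balance and imbalance of circles. -/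

import Mathlib

open Set

universe u₁ u₂ u₃ u₄ u₅

/-! ### Axiomatic projective geometry -/

/-- An axiomatic projective geometry on a type `P` of points.  The geometry without points and the
geometry with one point and no lines are allowed, and the dimension may be infinite. -/
structure ProjectiveGeometry (P : Type u₁) where
  /-- The lines, as sets of points. -/
  lines : Set (Set P)
  /-- Two distinct points lie on a unique line. -/
  existsUnique_line : ∀ p q : P, p ≠ q → ∃! L : Set P, L ∈ lines ∧ p ∈ L ∧ q ∈ L
  /-- Every line has at least three points. -/
  three_points : ∀ L ∈ lines, ∃ a ∈ L, ∃ b ∈ L, ∃ c ∈ L, a ≠ b ∧ a ≠ c ∧ b ≠ c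
  /-- For noncollinear points `p`, `q`, `r`, if `p'` is on the line `qr` and `q'` is on the
  line `pr`, then the lines `pp'` and `qq'` meet. -/
  veblen : ∀ p q r p' q' : P, (¬ ∃ L ∈ lines, p ∈ L ∧ q ∈ L ∧ r ∈ L) →
    ∀ L ∈ lines, q ∈ L → r ∈ L → p' ∈ L →
    ∀ M ∈ lines, p ∈ M → r ∈ M → q' ∈ M →
    ∀ A ∈ lines, p ∈ A → p' ∈ A →
    ∀ B ∈ lines, q ∈ B → q' ∈ B → (A ∩ B).Nonempty

namespace ProjectiveGeometry

variable {P : Type u₁} (G : ProjectiveGeometry P)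

/-- The line through `p` and `q` (meant for `p ≠ q`). -/
def line (p q : P) : Set P := {x | ∃ L ∈ G.lines, p ∈ L ∧ q ∈ L ∧ x ∈ L}

/-- A subspace, or flat, is a line-closed set of points. -/
def IsSubspace (t : Set P) : Prop :=
  ∀ p ∈ t, ∀ q ∈ t, p ≠ q → ∀ L ∈ G.lines, p ∈ L → q ∈ L → L ⊆ t

/-- The smallest subspace that contains `S`. -/
def span (S : Set P) : Set P := ⋂₀ {t | G.IsSubspace t ∧ S ⊆ t}

/-- `h` is a (relative) hyperplane of the subspace `t`: a maximal proper subspace of `t`. -/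
def IsHyperplaneOf (h t : Set P) : Prop :=
  G.IsSubspace h ∧ h ⊂ t ∧ ∀ s, G.IsSubspace s → h ⊂ s → s ⊆ t → s = t

/-- A set of points is independent if every proper subset spans a properly smaller subspace. -/
def Independent (S : Set P) : Prop := ∀ T, T ⊂ S → G.span T ⊂ G.span S

/-- `G` has coordinates in the skew field `F`, by means of the (left) vector space `V`: there is a
bijection from the points of `G` to the points of the projective space of `V` that identifies the
lines of `G` with the lines (the projectivized 2-dimensional subspaces of `V`). -/
def HasCoordinates (F : Type u₂) (V : Type u₃) [DivisionRing F] [AddCommGroup V] [Module F V] :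
    Prop :=
  ∃ φ : P ≃ Projectivization F V, ∀ L : Set P, L ∈ G.lines ↔
    ∃ W : Submodule F V, Module.finrank F W = 2 ∧
      φ '' L = (W.projectivization : Set (Projectivization F V))

end ProjectiveGeometry

/-! ### Circles and theta graphs in a multigraph, linear classes -/

namespace Graph

/-- A simple closed path of length `n + 2`; the indices are taken modulo `n + 2`. -/
structure ClosedPath {α : Type u₁} {β : Type u₂} (Γ : Graph α β) (n : ℕ) where
  node : Fin (n + 2) → α
  edge : Fin (n + 2) → β
  node_injective : Function.Injective node
  edge_injective : Function.Injective edge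
  isLink : ∀ i, Γ.IsLink (edge i) (node i) (node (i + 1))

/-- A circle is the edge set of a simple closed path. Circles of length 2 (digons) are allowed. -/
def IsCircle {α : Type u₁} {β : Type u₂} (Γ : Graph α β) (C : Set β) : Prop :=
  ∃ (n : ℕ) (W : Γ.ClosedPath n), range W.edge = C

/-- A simple path of length `n + 1` from `u` to `w`. -/
structure OpenPath {α : Type u₁} {β : Type u₂} (Γ : Graph α β) (u w : α) (n : ℕ) where
  node : Fin (n + 2) → α
  edge : Fin (n + 1) → β
  node_injective : Function.Injective node
  isLink : ∀ i, Γ.IsLink (edge i) (node i.castSucc) (node i.succ)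
  node_zero : node 0 = u
  node_last : node (Fin.last (n + 1)) = w

/-- `A₁`, `A₂`, `A₃` are the edge sets of three internally disjoint paths with the same two
endpoints, so that their union is a theta graph. -/
def IsTheta {α : Type u₁} {β : Type u₂} (Γ : Graph α β) (A₁ A₂ A₃ : Set β) : Prop :=
  ∃ (u w : α) (n₁ n₂ n₃ : ℕ)
    (W₁ : Γ.OpenPath u w n₁) (W₂ : Γ.OpenPath u w n₂) (W₃ : Γ.OpenPath u w n₃),
    range W₁.edge = A₁ ∧ range W₂.edge = A₂ ∧ range W₃.edge = A₃ ∧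
    range W₁.node ∩ range W₂.node = {u, w} ∧
    range W₁.node ∩ range W₃.node = {u, w} ∧
    range W₂.node ∩ range W₃.node = {u, w} ∧
    Disjoint A₁ A₂ ∧ Disjoint A₁ A₃ ∧ Disjoint A₂ A₃

/-- `B` is a linear class of circles of `Γ`: in a theta subgraph, whose three circles are
`A₁ ∪ A₂`, `A₁ ∪ A₃` and `A₂ ∪ A₃`, the number of circles in `B` is never exactly two.
(The three paths may be permuted, so that the implication below says just this.) -/
def IsLinearClass {α : Type u₁} {β : Type u₂} (Γ : Graph α β) (B : Set (Set β)) : Prop :=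
  (∀ C ∈ B, Γ.IsCircle C) ∧
  ∀ A₁ A₂ A₃, Γ.IsTheta A₁ A₂ A₃ → A₁ ∪ A₂ ∈ B → A₁ ∪ A₃ ∈ B → A₂ ∪ A₃ ∈ B

/-- A simple graph has no circle with at most two edges. -/
theorem IsCircle.not_subset_pair {α : Type u₁} {β : Type u₂} {Γ : Graph α β} [Γ.Simple]
    {C : Set β} (hC : Γ.IsCircle C) (e f : β) : ¬ C ⊆ {e, f} := by
  obtain ⟨n, W, rfl⟩ := hC
  intro h
  have hmem : ∀ i, W.edge i = e ∨ W.edge i = f := fun i => h (mem_range_self i)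
  rcases n with _ | n
  · have h0 := W.isLink 0
    have h1 := W.isLink 1
    have h2 : ((1 : Fin 2) + 1) = 0 := rfl
    have := W.edge_injective (h0.eq (by simpa [h2] using h1.symm))
    exact absurd this (by decide)
  · have h01 : W.edge ⟨0, by omega⟩ ≠ W.edge ⟨1, by omega⟩ :=
      fun hh => absurd (W.edge_injective hh) (by simp)
    have h02 : W.edge ⟨0, by omega⟩ ≠ W.edge ⟨2, by omega⟩ :=
      fun hh => absurd (W.edge_injective hh) (by simp)
    have h12 : W.edge ⟨1, by omega⟩ ≠ W.edge ⟨2, by omega⟩ :=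
      fun hh => absurd (W.edge_injective hh) (by simp)
    grind

end Graph

/-! ### Biased expansions and group expansions -/

/-- The data from which a biased expansion of `Δ` is made: a graph, a class of edge sets
(the balanced circles), and a projection of the edges to the edges of `Δ`.
The axioms of a biased expansion are in `ExpansionData.IsBiasedExpansion`. -/
structure ExpansionData {α : Type u₁} {β : Type u₂} (Δ : Graph α β) (γ : Type u₃) where
  graph : Graph α γ
  balanced : Set (Set γ)
  proj : graph.edgeSet → Δ.edgeSet

namespace ExpansionData

variable {α : Type u₁} {β : Type u₂} {Δ : Graph α β} {γ : Type u₃} {γ' : Type u₄}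

/-- `(graph, balanced)` is a biased graph (without loops and half edges). -/
def IsBiasedGraph (X : ExpansionData Δ γ) : Prop :=
  X.graph.Loopless ∧ X.graph.IsLinearClass X.balanced

/-- `X` is a biased expansion of `Δ`: it is a biased graph, the projection is a surjective graph
homomorphism to `Δ` that is the identity on nodes, and, for each circle `C` of `Δ`, each edge `e` of
`C` and each choice of edges `s f` over the edges `f ≠ e` of `C`, there is a unique edge over `e`
that completes the chosen edges to a balanced circle. -/
def IsBiasedExpansion (X : ExpansionData Δ γ) : Prop :=
  X.IsBiasedGraph ∧
  X.graph.vertexSet = Δ.vertexSet ∧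
  (∀ (x : X.graph.edgeSet) (u v : α), X.graph.IsLink x u v → Δ.IsLink (X.proj x) u v) ∧
  Function.Surjective X.proj ∧
  ∀ C : Set β, Δ.IsCircle C → ∀ e : Δ.edgeSet, (e : β) ∈ C →
    ∀ s : Δ.edgeSet → X.graph.edgeSet, (∀ f : Δ.edgeSet, (f : β) ∈ C → f ≠ e → X.proj (s f) = f) →
      ∃! x : X.graph.edgeSet, X.proj x = e ∧
        insert (x : γ) ((fun f : Δ.edgeSet => (s f : γ)) '' {f | (f : β) ∈ C ∧ f ≠ e}) ∈ X.balanced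

/-- Equality of biased graphs over `Δ` up to the names of the edges: an isomorphism
that is the identity on nodes, commutes with the projections to `Δ`, and preserves balance and
imbalance of circles. -/
def StablyIsomorphic (X : ExpansionData Δ γ) (Y : ExpansionData Δ γ') : Prop :=
  X.graph.vertexSet = Y.graph.vertexSet ∧
  ∃ φ : X.graph.edgeSet ≃ Y.graph.edgeSet,
    (∀ (x : X.graph.edgeSet) (u v : α), X.graph.IsLink x u v ↔ Y.graph.IsLink (φ x) u v) ∧
    (∀ x, Y.proj (φ x) = X.proj x) ∧
    ∀ C : Set X.graph.edgeSet,
      Subtype.val '' C ∈ X.balanced ↔ Subtype.val '' (φ '' C) ∈ Y.balanced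

end ExpansionData

namespace Graph

/-- An orientation of a graph: a choice of direction for each edge. -/
structure Orientation {α : Type u₁} {β : Type u₂} (Δ : Graph α β) where
  tail : Δ.edgeSet → α
  head : Δ.edgeSet → α
  isLink : ∀ e : Δ.edgeSet, Δ.IsLink e (tail e) (head e)

variable {α : Type u₁} {β : Type u₂} {Δ : Graph α β}

/-- The underlying graph of the expansion of `Δ` by `A`: the edge set is `A × E(Δ)`, and
`(g, e)` has the same ends as `e`. -/
def expansionGraph (Δ : Graph α β) (A : Type u₃) : Graph α (A × Δ.edgeSet) where
  vertexSet := Δ.vertexSet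
  IsLink x u v := Δ.IsLink x.2 u v
  isLink_symm _ _ := ⟨fun _ _ h => h.symm⟩
  eq_or_eq_of_isLink_of_isLink _ _ _ _ _ h h' := h.left_eq_or_eq h'
  left_mem_of_isLink _ _ _ h := h.left_mem

open Classical in
/-- The gain of the edge `(g, e)` of the expansion of `Δ`, traversed from its end `u` to the other
end: `g` in the direction of `e`, and `-g` in the opposite direction. -/
noncomputable def Orientation.gain (O : Δ.Orientation) {A : Type u₃} [AddCommGroup A]
    (x : A × Δ.edgeSet) (u : α) : A :=
  if O.tail x.2 = u then x.1 else -x.1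

/-- The biased graph `⟨A Δ⟩` of the group expansion of `Δ` by the (additively written, abelian)
group `A`: a circle is balanced if its gain, summed in the direction of a closed walk around
it, is zero. -/
noncomputable def groupExpansion (O : Δ.Orientation) (A : Type u₃) [AddCommGroup A] :
    ExpansionData Δ (A × Δ.edgeSet) where
  graph := Δ.expansionGraph A
  balanced := {C | ∃ (n : ℕ) (W : (Δ.expansionGraph A).ClosedPath n),
    range W.edge = C ∧ ∑ i, O.gain (W.edge i) (W.node i) = 0}
  proj x := x.1.2

end Graph

/-! ### Projective orthography -/

/-- The data for a projective orthographic representation: a projective geometry on `P` with a base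
hyperplane `base`, a projective representation `z` in `base` of the graphic matroid of `Δ`
(an edge set is independent in the graphic matroid, that is, it contains no circle, if and only if
`z` maps it injectively to an independent set of points), and a point `apex` off the base. -/
structure OrthographicFrame {α : Type u₁} {β : Type u₂} (Δ : Graph α β) (P : Type u₃) where
  geometry : ProjectiveGeometry P
  base : Set P
  isHyperplane : geometry.IsHyperplaneOf base univ
  z : Δ.edgeSet → P
  z_mem : ∀ e, z e ∈ base
  represents : ∀ S : Set Δ.edgeSet,
    (¬ ∃ C : Set β, Δ.IsCircle C ∧ C ⊆ Subtype.val '' S) ↔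
      InjOn z S ∧ geometry.Independent (z '' S)
  apex : P
  apex_notMem : apex ∉ base

namespace OrthographicFrame

variable {α : Type u₁} {β : Type u₂} {Δ : Graph α β} {P : Type u₃} (D : OrthographicFrame Δ P)

/-- The edge line of `e`: the line through `z e` and the apex. -/
def edgeLine (e : Δ.edgeSet) : Set P := D.geometry.line (D.z e) D.apex

/-- The union of the edge lines. -/
def edgePoints : Set P := ⋃ e, D.edgeLine e

theorem z_injective [Δ.Simple] : Function.Injective D.z := by
  intro e f hef
  have h := (D.represents {e, f}).1 (by
    rintro ⟨C, hC, hsub⟩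
    exact hC.not_subset_pair e f (by simpa [image_pair] using hsub))
  exact h.1 (by simp) (by simp) hef

/-- A point other than the apex lies on at most one edge line. -/
theorem edgeLine_unique [Δ.Simple] {x : P} (hx : x ≠ D.apex) {e f : Δ.edgeSet}
    (he : x ∈ D.edgeLine e) (hf : x ∈ D.edgeLine f) : e = f := by
  obtain ⟨L, hL, heL, haL, hxL⟩ := he
  obtain ⟨M, hM, hfM, haM, hxM⟩ := hf
  obtain rfl : L = M := (D.geometry.existsUnique_line x D.apex hx).unique
    ⟨hL, hxL, haL⟩ ⟨hM, hxM, haM⟩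
  by_contra hne
  exact D.apex_notMem (D.isHyperplane.1 _ (D.z_mem e) _ (D.z_mem f)
    (fun h => hne (D.z_injective h)) L hL heL hfM haL)

section Omega

theorem exists_edge (Ehat : Set P) (hE : Ehat ⊆ D.edgePoints \ {D.apex}) (x : Ehat) : ∃ e : Δ.edgeSet, (x : P) ∈ D.edgeLine e :=
  mem_iUnion.1 (hE x.2).1

variable (Ehat : Set P) (hE : Ehat ⊆ D.edgePoints \ {D.apex})

/-- The projection `p`: the edge of `Δ` whose edge line contains the given point. -/
noncomputable def edgeProj (x : Ehat) : Δ.edgeSet := (D.exists_edge Ehat hE x).choose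

theorem mem_edgeLine_edgeProj (x : Ehat) : (x : P) ∈ D.edgeLine (D.edgeProj Ehat hE x) :=
  (D.exists_edge Ehat hE x).choose_spec

variable [Δ.Simple]

/-- The graph with the node set of `Δ` and edge set `Ehat`, in which a point has the same
ends as the edge of `Δ` to which it projects. -/
def omegaGraph : Graph α P where
  vertexSet := Δ.vertexSet
  edgeSet := Ehat
  IsLink x u v := x ∈ Ehat ∧ ∃ e : Δ.edgeSet, x ∈ D.edgeLine e ∧ Δ.IsLink e u v
  isLink_symm _ _ := ⟨fun _ _ ⟨hx, e, he, h⟩ => ⟨hx, e, he, h.symm⟩⟩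
  eq_or_eq_of_isLink_of_isLink := by
    rintro x a b c d ⟨hx, e, he, h⟩ ⟨-, f, hf, h'⟩
    obtain rfl := D.edgeLine_unique (hE hx).2 he hf
    exact h.left_eq_or_eq h'
  edge_mem_iff_exists_isLink x := by
    refine ⟨fun hx => ?_, fun ⟨_, _, hx, _⟩ => hx⟩
    obtain ⟨e, he⟩ := D.exists_edge Ehat hE ⟨x, hx⟩
    obtain ⟨u, v, huv⟩ := Graph.exists_isLink_of_mem_edgeSet e.2
    exact ⟨u, v, hx, e, he, huv⟩
  left_mem_of_isLink := fun _ _ _ ⟨_, _, _, h⟩ => h.left_mem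

/-- `Ω₀(Ehat)`: the edges are the points of `Ehat`, and a circle is balanced if it spans a
cross-flat, that is, a flat that does not contain the apex. -/
noncomputable def omega : ExpansionData Δ P where
  graph := D.omegaGraph Ehat hE
  balanced := {C | (D.omegaGraph Ehat hE).IsCircle C ∧ D.apex ∉ D.geometry.span C}
  proj := D.edgeProj Ehat hE

end Omega

/-- `Ω₀` of the set of all points, other than the apex, on all edge lines. -/
noncomputable def fullOmega [Δ.Simple] : ExpansionData Δ P :=
  D.omega (D.edgePoints \ {D.apex}) Subset.rfl

/-- `z` represents `Δ` in an affine part of the base, that is, in the complement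
of a hyperplane of the base. -/
def IsInAffinePart : Prop :=
  ∃ h : Set P, D.geometry.IsHyperplaneOf h D.base ∧ ∀ e, D.z e ∈ D.base \ h

end OrthographicFrame

/-! ### Flats of a projective geometry: cones and the exchange property. -/

namespace ProjectiveGeometry

variable {P : Type u₁} (G : ProjectiveGeometry P)

/-! Part (I) rests on one fact, `apex_notMem_span`: a finite circle-free set of edges of Ω spans a
flat that misses the apex. Otherwise, when the points are added one by one, the exchange property
puts some new point in the join of the apex and its predecessors. Projection from the apex to the
base then makes some `z e` depend on the images of earlier edges, although all these edges form a
forest of Δ.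

Conversely, `z` maps a circle of Δ to a minimal dependent set. Choose points over all its edges but
`e`: the join of their span with the apex contains the edge line of `e`, so the span, which misses
the apex, meets this line in exactly one point. This is the expansion property. It also shows that
each point of a balanced circle is spanned by the others. Hence, if two circles of a theta graph are
balanced, the third lies in the span of the forest that is left when one edge is removed from each
of two paths, and so it is balanced too.

Part (II) rests on `exists_vector_potential`: vectors that represent the graphic matroid can be
rescaled to differences `θ w - θ u` of a function `θ` on the nodes. Modulo the edges away from a
node, the relation of a circle has just two terms, which yields coefficients at each edge end that
are independent of the circle. They are then normalized by a potential in the multiplicative group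
of the skew field, after which the rescaled edge vectors sum to zero around each circle and have a
potential in `V`.

A linear form `l` that vanishes on no edge vector gives the coloring `l ∘ θ`. Conversely, the
differences of a coloring are the values of a linear form, since all relations between edge vectors
come from circles. Finally, if `a` is a vector of the apex, the points of an edge line other than
the apex are represented by `θ head - θ tail + g • a` with a unique scalar `g`. Around a circle the
signed sum of these vectors telescopes to the total gain times `a`; hence balance means gain zero.
-/

theorem eq_of_mem_lines {L M : Set P} (hL : L ∈ G.lines) (hM : M ∈ G.lines) {p q : P} (hpq : p ≠ q)
    (hpL : p ∈ L) (hqL : q ∈ L) (hpM : p ∈ M) (hqM : q ∈ M) : L = M :=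
  (G.existsUnique_line p q hpq).unique ⟨hL, hpL, hqL⟩ ⟨hM, hpM, hqM⟩

theorem exists_line {p q : P} (hpq : p ≠ q) : ∃ L ∈ G.lines, p ∈ L ∧ q ∈ L :=
  (G.existsUnique_line p q hpq).exists

theorem isSubspace_span (S : Set P) : G.IsSubspace (G.span S) := by
  intro p hp q hq hpq L hL hpL hqL x hx t ht
  exact ht.1 p (hp t ht) q (hq t ht) hpq L hL hpL hqL hx

theorem subset_span (S : Set P) : S ⊆ G.span S := fun _ hx _ ht => ht.2 hx

theorem span_subset {S t : Set P} (ht : G.IsSubspace t) (h : S ⊆ t) : G.span S ⊆ t :=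
  fun _ hx => hx t ⟨ht, h⟩

theorem span_subset_span {S T : Set P} (h : S ⊆ G.span T) : G.span S ⊆ G.span T :=
  G.span_subset (G.isSubspace_span T) h

theorem span_mono {S T : Set P} (h : S ⊆ T) : G.span S ⊆ G.span T :=
  G.span_subset_span (h.trans (G.subset_span T))

/-- A line that meets two sides of a triangle with apex `p` and base in the flat `t`, away from `p`,
has all its points on the lines from `p` to `t`. -/
theorem mem_cone_of_transversal {t : Set P} (ht : G.IsSubspace t) {p : P} (hp : p ∉ t)
    {a b : P} (ha : a ∈ t) (hb : b ∈ t) {x y w : P} {A B M : Set P}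
    (hA : A ∈ G.lines) (hpA : p ∈ A) (haA : a ∈ A) (hxA : x ∈ A)
    (hB : B ∈ G.lines) (hpB : p ∈ B) (hbB : b ∈ B) (hyB : y ∈ B)
    (hM : M ∈ G.lines) (hxM : x ∈ M) (hyM : y ∈ M) (hwM : w ∈ M)
    (hyp : y ≠ p) (hAB : A ≠ B) (hwx : w ≠ x) (hxa : x ≠ a) :
    ∃ d ∈ t, w ∈ G.line p d := by
  have hpa : p ≠ a := fun h => hp (h ▸ ha)
  have hpb : p ≠ b := fun h => hp (h ▸ hb)
  have hab : a ≠ b := by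
    rintro rfl; exact hAB (G.eq_of_mem_lines hA hB hpa hpA haA hpB hbB)
  obtain ⟨D, hD, haD, hbD⟩ := G.exists_line hab
  have hDt : D ⊆ t := ht a ha b hb hab D hD haD hbD
  have hyA : y ∉ A := fun h => hAB (G.eq_of_mem_lines hA hB hyp.symm hpA h hpB hyB)
  have hMA : M ≠ A := fun h => hyA (h ▸ hyM)
  -- In the triangle `y`, `a`, `p`, with `x` on `ap` and `b` on `yp`, the lines `M` and `ab` meet.
  obtain ⟨c, hcM, hcD⟩ := G.veblen y a p x b
    (by
      rintro ⟨L, hL, h1, h2, h3⟩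
      exact hyA (G.eq_of_mem_lines hL hA hpa h3 h2 hpA haA ▸ h1))
    A hA haA hpA hxA B hB hyB hpB hbB M hM hyM hxM D hD haD hbD
  by_cases hwp : w = p
  · exact ⟨a, ha, A, hA, hpA, haA, hwp ▸ hpA⟩
  have hca : c ≠ a := by
    rintro rfl; exact hMA (G.eq_of_mem_lines hM hA hxa hxM hcM hxA haA)
  obtain ⟨E, hE, hwE, hpE⟩ := G.exists_line hwp
  -- The second use of the axiom is in the triangle `w`, `a`, `x`, with `p` on `ax` and `c` on `wx`:
  -- the lines `wp` and `ac` meet.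
  obtain ⟨d, hdE, hdD⟩ := G.veblen w a x p c
    (by
      rintro ⟨L, hL, h1, h2, h3⟩
      obtain rfl := G.eq_of_mem_lines hL hA hxa h3 h2 hxA haA
      exact hMA (G.eq_of_mem_lines hM hL hwx hwM hxM h1 h3))
    A hA haA hxA hpA M hM hwM hxM hcM E hE hwE hpE D hD haD hcD
  exact ⟨d, hDt hdD, E, hE, hpE, hdE, hwE⟩

/-- The cone over a nonempty flat is a flat. -/
theorem isSubspace_cone {t : Set P} (ht : G.IsSubspace t) {p : P} (hp : p ∉ t) :
    G.IsSubspace {x | ∃ a ∈ t, x ∈ G.line p a} := by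
  rintro x ⟨a, ha, A, hA, hpA, haA, hxA⟩ y ⟨b, hb, B, hB, hpB, hbB, hyB⟩ hxy M hM hxM hyM w hwM
  have hpa : p ≠ a := fun h => hp (h ▸ ha)
  have hpb : p ≠ b := fun h => hp (h ▸ hb)
  by_cases hAB : A = B
  · subst hAB
    obtain rfl := G.eq_of_mem_lines hM hA hxy hxM hyM hxA hyB
    exact ⟨a, ha, M, hM, hpA, haA, hwM⟩
  by_cases hxp : x = p
  · subst hxp
    obtain rfl := G.eq_of_mem_lines hM hB hxy hxM hyM hpB hyB
    exact ⟨b, hb, M, hM, hpB, hbB, hwM⟩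
  by_cases hyp : y = p
  · subst hyp
    obtain rfl := G.eq_of_mem_lines hM hA hxy hxM hyM hxA hpA
    exact ⟨a, ha, M, hM, hpA, haA, hwM⟩
  by_cases hwx : w = x
  · subst hwx
    exact ⟨a, ha, A, hA, hpA, haA, hxA⟩
  by_cases hwy : w = y
  · subst hwy
    exact ⟨b, hb, B, hB, hpB, hbB, hyB⟩
  -- The lemma on transversals needs `x ≠ a` or, with the roles exchanged, `y ≠ b`. If both fail,
  -- `M` lies in `t`.
  by_cases hxa : x = a
  · by_cases hyb : y = b
    · subst hxa hyb
      have hw : w ∈ t := ht x ha y hb hxy M hM hxM hyM hwM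
      obtain ⟨L, hL, h1, h2⟩ := G.exists_line (fun h : p = w => hp (h ▸ hw))
      exact ⟨w, hw, L, hL, h1, h2, h2⟩
    · exact G.mem_cone_of_transversal ht hp hb ha hB hpB hbB hyB hA hpA haA hxA hM hyM hxM hwM
        hxp (Ne.symm hAB) hwy hyb
  · exact G.mem_cone_of_transversal ht hp ha hb hA hpA haA hxA hB hpB hbB hyB hM hxM hyM hwM
      hyp hAB hwx hxa

theorem exists_mem_line_of_mem_span_insert {t : Set P} (ht : G.IsSubspace t) {p : P} (hp : p ∉ t)
    {x : P} (hx : x ∈ G.span (insert p t)) (hxp : x ≠ p) : ∃ a ∈ t, x ∈ G.line p a := by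
  -- The cone over the empty flat is empty and does not contain `p`, so this case is separate.
  rcases t.eq_empty_or_nonempty with rfl | hne
  · refine absurd (G.span_subset (t := {p}) ?_ (by simp) hx) hxp
    rintro x rfl y rfl h; exact absurd rfl h
  · refine G.span_subset (G.isSubspace_cone ht hp) (insert_subset ?_ ?_) hx
    · obtain ⟨a, ha⟩ := hne
      obtain ⟨L, hL, h1, h2⟩ := G.exists_line (fun h : p = a => hp (h ▸ ha))
      exact ⟨a, ha, L, hL, h1, h2, h1⟩
    · intro a ha
      obtain ⟨L, hL, h1, h2⟩ := G.exists_line (fun h : p = a => hp (h ▸ ha))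
      exact ⟨a, ha, L, hL, h1, h2, h2⟩

theorem span_insert_span (p : P) (S : Set P) :
    G.span (insert p (G.span S)) = G.span (insert p S) := by
  refine (G.span_subset_span (insert_subset ?_ ?_)).antisymm (G.span_mono ?_)
  · exact G.subset_span _ (mem_insert _ _)
  · exact G.span_mono (subset_insert _ _)
  · exact insert_subset_insert (G.subset_span S)

/-- The exchange property. -/
theorem mem_span_insert_exchange {S : Set P} {x y : P} (hy : y ∈ G.span (insert x S))
    (hyS : y ∉ G.span S) : x ∈ G.span (insert y S) := by
  by_cases hx : x ∈ G.span S
  · exact absurd (G.span_subset_span (insert_subset hx (G.subset_span S)) hy) hyS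
  by_cases hyx : y = x
  · exact hyx ▸ G.subset_span _ (mem_insert _ _)
  rw [← span_insert_span] at hy
  obtain ⟨a, ha, L, hL, hxL, haL, hyL⟩ :=
    G.exists_mem_line_of_mem_span_insert (G.isSubspace_span S) hx hy hyx
  have hay : a ≠ y := fun h => hyS (h ▸ ha)
  exact G.isSubspace_span _ a (G.span_mono (subset_insert _ _) ha) y
    (G.subset_span _ (mem_insert _ _)) hay L hL haL hyL hxL

theorem Independent.notMem_span {G : ProjectiveGeometry P} {S : Set P} (hS : G.Independent S)
    {x : P} (hx : x ∈ S) : x ∉ G.span (S \ {x}) := by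
  intro h
  refine (hS (S \ {x}) ⟨sdiff_subset, fun h' => (h' hx).2 rfl⟩).2 (G.span_subset_span fun y hy => ?_)
  by_cases hyx : y = x
  · exact hyx ▸ h
  · exact G.subset_span _ ⟨hy, hyx⟩

/-- In a minimal dependent set each point is in the span of the others. -/
theorem mem_span_diff_of_not_independent {S : Set P} (hS : ¬ G.Independent S)
    (hmin : ∀ x ∈ S, G.Independent (S \ {x})) {x : P} (hx : x ∈ S) : x ∈ G.span (S \ {x}) := by
  obtain ⟨T, hTS, hT⟩ : ∃ T, T ⊂ S ∧ ¬ G.span T ⊂ G.span S := by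
    simpa [Independent] using hS
  have hST : S ⊆ G.span T := by
    by_contra h
    exact hT ⟨G.span_mono hTS.1, fun h' => h ((G.subset_span S).trans h')⟩
  -- Dependence only gives some redundant point `y`; minimality and exchange transfer the redundancy
  -- to the given `x`.
  obtain ⟨y, hyS, hyT⟩ := exists_of_ssubset hTS
  have hy : y ∈ G.span (S \ {y}) :=
    G.span_mono (subset_sdiff_singleton hTS.1 hyT) (hST hyS)
  by_cases hyx : y = x
  · exact hyx ▸ hy
  have h1 : y ∉ G.span ((S \ {x}) \ {y}) := (hmin x hx).notMem_span ⟨hyS, hyx⟩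
  have h2 : insert x ((S \ {x}) \ {y}) = S \ {y} := by
    ext z; simp only [mem_insert_iff, mem_sdiff, mem_singleton_iff]; grind
  have h3 : insert y ((S \ {x}) \ {y}) = S \ {x} := by
    ext z; simp only [mem_insert_iff, mem_sdiff, mem_singleton_iff]; grind
  rw [← h3]
  exact G.mem_span_insert_exchange (h2 ▸ hy) h1

end ProjectiveGeometry

/-! ### Circle-free edge sets, paths and theta graphs. -/

namespace Graph

variable {α : Type u₁} {β : Type u₂} {Γ : Graph α β}

/-- A set of edges is circle-free if it contains no circle. -/
def CircleFree (Γ : Graph α β) (S : Set β) : Prop := ¬ ∃ C, Γ.IsCircle C ∧ C ⊆ S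

theorem CircleFree.mono {S T : Set β} (hT : Γ.CircleFree T) (h : S ⊆ T) : Γ.CircleFree S :=
  fun ⟨C, hC, hCS⟩ => hT ⟨C, hC, hCS.trans h⟩

theorem circleFree_empty : Γ.CircleFree ∅ := by
  rintro ⟨_, ⟨n, W, rfl⟩, h⟩
  exact h (mem_range_self 0)

namespace ClosedPath

variable {n : ℕ} (W : Γ.ClosedPath n)

theorem inc_left (i : Fin (n + 2)) : Γ.Inc (W.edge i) (W.node i) := (W.isLink i).inc_left

theorem inc_right (i : Fin (n + 2)) : Γ.Inc (W.edge i) (W.node (i + 1)) := (W.isLink i).inc_right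

theorem edge_mem (i : Fin (n + 2)) : W.edge i ∈ Γ.edgeSet := (W.isLink i).edge_mem

theorem eq_or_eq_of_inc {i j : Fin (n + 2)} (h : Γ.Inc (W.edge i) (W.node j)) :
    j = i ∨ j = i + 1 :=
  (h.eq_or_eq_of_isLink (W.isLink i)).imp (fun h => W.node_injective h)
    (fun h => W.node_injective h)

/-- The closed path with a shifted starting point. -/
@[simps]
def rotate (k : Fin (n + 2)) : Γ.ClosedPath n where
  node i := W.node (i + k)
  edge i := W.edge (i + k)
  node_injective _ _ h := add_right_cancel (W.node_injective h)
  edge_injective _ _ h := add_right_cancel (W.edge_injective h)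
  isLink i := by simpa only [add_right_comm] using W.isLink (i + k)

/-- The open path that is left when the last edge of a closed path is removed. -/
@[simps]
def toOpenPath : Γ.OpenPath (W.node 0) (W.node (Fin.last (n + 1))) n where
  node := W.node
  edge i := W.edge i.castSucc
  node_injective := W.node_injective
  isLink i := by simpa using W.isLink i.castSucc
  node_zero := rfl
  node_last := rfl

end ClosedPath

/-- An edge at a node that meets no edge of a circle-free set can be added to the set. -/
theorem CircleFree.insert_of_inc {S : Set β} (hS : Γ.CircleFree S) {v : α}
    (hv : ∀ f ∈ S, ¬ Γ.Inc f v) {e : β} (he : Γ.Inc e v) : Γ.CircleFree (insert e S) := by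
  rintro ⟨_, ⟨n, W, rfl⟩, h⟩
  by_cases hmem : e ∈ range W.edge
  · obtain ⟨i, rfl⟩ := hmem
    -- A circle through `e` has a second edge at `v`, which precedes or follows `e` on the closed
    -- path; this edge would be in `S`.
    have key : ∀ j, j ≠ i → ¬ Γ.Inc (W.edge j) v := fun j hj =>
      hv _ ((h (mem_range_self j)).resolve_left fun hh => hj (W.edge_injective hh))
    rcases he.eq_or_eq_of_isLink (W.isLink i) with rfl | rfl
    · have := W.inc_right (i - 1)
      rw [sub_add_cancel] at this
      exact key (i - 1) (by simp) this
    · exact key (i + 1) (by simp) (W.inc_left (i + 1))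
  · exact hS ⟨_, ⟨n, W, rfl⟩, (subset_insert_iff_of_notMem hmem).1 h⟩

namespace OpenPath

variable {u w : α} {n : ℕ} (W : Γ.OpenPath u w n)

theorem eq_or_eq_of_inc {i : Fin (n + 1)} {j : Fin (n + 2)} (h : Γ.Inc (W.edge i) (W.node j)) :
    j = i.castSucc ∨ j = i.succ :=
  (h.eq_or_eq_of_isLink (W.isLink i)).imp (fun h => W.node_injective h)
    (fun h => W.node_injective h)

theorem eq_zero_of_node_eq {i : Fin (n + 2)} (h : W.node i = u) : i = 0 :=
  W.node_injective (h.trans W.node_zero.symm)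

theorem eq_last_of_node_eq {i : Fin (n + 2)} (h : W.node i = w) : i = Fin.last (n + 1) :=
  W.node_injective (h.trans W.node_last.symm)

theorem edge_injective : Function.Injective W.edge := by
  intro i j h
  have h1 := W.eq_or_eq_of_inc (i := j) (h ▸ (W.isLink i).inc_left)
  have h2 := W.eq_or_eq_of_inc (i := j) (h ▸ (W.isLink i).inc_right)
  simp only [Fin.ext_iff, Fin.val_castSucc, Fin.val_succ] at h1 h2 ⊢
  omega

/-- An initial segment of a path can be added to a circle-free set that meets the segment at most in
its first node. -/
theorem circleFree_union {S : Set β} (hS : Γ.CircleFree S) (k : ℕ)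
    (hk : ∀ i : Fin (n + 2), i ≠ 0 → (i : ℕ) ≤ k → ∀ f ∈ S, ¬ Γ.Inc f (W.node i)) :
    Γ.CircleFree (S ∪ W.edge '' {i | (i : ℕ) < k}) := by
  induction k with
  | zero => simpa using hS
  | succ k ih =>
    have ih := ih fun i h0 hi => hk i h0 (by omega)
    by_cases hkn : k < n + 1
    · refine (ih.insert_of_inc (v := W.node (Fin.succ ⟨k, hkn⟩)) ?_
        (W.isLink ⟨k, hkn⟩).inc_right).mono ?_
      · rintro f (hf | ⟨i, hi, rfl⟩) hinc
        · exact hk _ (Fin.succ_ne_zero _) (by simp) f hf hinc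
        · have := W.eq_or_eq_of_inc hinc
          simp only [Fin.ext_iff, Fin.val_castSucc, Fin.val_succ, mem_ofPred_eq] at this hi
          omega
      · rintro f (hf | ⟨i, hi, rfl⟩)
        · exact Or.inr (Or.inl hf)
        · rcases Nat.lt_succ_iff_lt_or_eq.1 hi with hi | rfl
          · exact Or.inr (Or.inr ⟨i, hi, rfl⟩)
          · exact Or.inl rfl
    · refine ih.mono (union_subset_union_right _ (image_mono fun i _ => ?_))
      have := i.2
      simp only [mem_ofPred_eq]
      omega

theorem circleFree_range : Γ.CircleFree (range W.edge) := by
  refine (W.circleFree_union circleFree_empty (n + 1) (by simp)).mono ?_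
  rintro _ ⟨i, rfl⟩
  exact Or.inr ⟨i, i.2, rfl⟩

end OpenPath

/-- After a rotation by `i + 1` the removed edge is the last one, and the rest is a simple path. -/
theorem ClosedPath.circleFree_diff_edge {n : ℕ} (W : Γ.ClosedPath n) (i : Fin (n + 2)) :
    Γ.CircleFree (range W.edge \ {W.edge i}) := by
  refine (W.rotate (i + 1)).toOpenPath.circleFree_range.mono ?_
  rintro _ ⟨⟨j, rfl⟩, hj⟩
  have hne : j - (i + 1) ≠ Fin.last (n + 1) := by
    intro h
    refine hj (congrArg W.edge ?_)
    rw [sub_eq_iff_eq_add] at h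
    rw [h, add_comm i, ← add_assoc, Fin.last_add_one, zero_add]
  refine ⟨(j - (i + 1)).castPred hne, ?_⟩
  simp

theorem IsCircle.circleFree_diff {C : Set β} (hC : Γ.IsCircle C) {e : β} (he : e ∈ C) :
    Γ.CircleFree (C \ {e}) := by
  obtain ⟨n, W, rfl⟩ := hC
  obtain ⟨i, rfl⟩ := he
  exact W.circleFree_diff_edge i

theorem IsCircle.finite {C : Set β} (hC : Γ.IsCircle C) : C.Finite := by
  obtain ⟨n, W, rfl⟩ := hC
  exact finite_range _

theorem IsCircle.subset_edgeSet {C : Set β} (hC : Γ.IsCircle C) : C ⊆ Γ.edgeSet := by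
  obtain ⟨n, W, rfl⟩ := hC
  rintro _ ⟨i, rfl⟩
  exact W.edge_mem i

/-- The closed path made of two internally disjoint paths with the same ends. -/
def OpenPath.closedPath {u w : α} {n m : ℕ} (W : Γ.OpenPath u w n) (X : Γ.OpenPath u w m)
    (hnode : range W.node ∩ range X.node = {u, w}) (hedge : Disjoint (range W.edge) (range X.edge)) :
    Γ.ClosedPath (n + m) where
  -- `W` is followed up to its node `n`, and then `X` backwards from its last node, which is `w`, to
  -- its node of index 1. Thus neither `u` nor `w` is repeated.
  node i := if h : (i : ℕ) < n + 1 then W.node ⟨i, by omega⟩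
    else X.node ⟨n + m + 2 - i, by omega⟩
  edge i := if h : (i : ℕ) < n + 1 then W.edge ⟨i, by omega⟩
    else X.edge ⟨n + m + 1 - i, by omega⟩
  node_injective := by
    have key : ∀ (a : Fin (n + 2)) (b : Fin (m + 2)), (a : ℕ) < n + 1 → (b : ℕ) ≠ 0 →
        W.node a ≠ X.node b := by
      intro a b ha hb hab
      have : W.node a ∈ ({u, w} : Set α) := hnode ▸ ⟨mem_range_self a, hab ▸ mem_range_self b⟩
      rcases this with h | h
      · exact hb (congrArg Fin.val (X.eq_zero_of_node_eq (hab.symm.trans h)))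
      · have := congrArg Fin.val (W.eq_last_of_node_eq h)
        simp only [Fin.val_last] at this
        omega
    intro i j h
    simp only at h
    split_ifs at h with hi hj hj
    · have := W.node_injective h
      simpa [Fin.ext_iff] using this
    · exact absurd h (key _ _ hi (by simp only; omega))
    · exact absurd h.symm (key _ _ hj (by simp only; omega))
    · have := X.node_injective h
      simp only [Fin.ext_iff] at this ⊢
      omega
  edge_injective := by
    have key : ∀ a b, W.edge a ≠ X.edge b := fun a b h =>
      disjoint_left.1 hedge (mem_range_self a) (h ▸ mem_range_self b)
    intro i j h
    simp only at h
    split_ifs at h with hi hj hj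
    · have := W.edge_injective h
      simpa [Fin.ext_iff] using this
    · exact absurd h (key _ _)
    · exact absurd h.symm (key _ _)
    · have := X.edge_injective h
      simp only [Fin.ext_iff] at this ⊢
      omega
  isLink i := by
    have hval : ((i + 1 : Fin (n + m + 2)) : ℕ) = if (i : ℕ) = n + m + 1 then 0 else (i : ℕ) + 1 := by
      rw [Fin.val_add_one]
      simp [Fin.ext_iff]
    by_cases hi : (i : ℕ) < n + 1
    · have h1 := W.isLink ⟨i, hi⟩
      have hne : (i : ℕ) ≠ n + m + 1 := by omega
      simp only [hi, dite_true, hval, hne, if_false]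
      by_cases hi' : (i : ℕ) + 1 < n + 1
      · simpa [hi'] using h1
      · simp only [hi', dite_false]
        have e1 : (Fin.succ ⟨i, hi⟩ : Fin (n + 2)) = Fin.last (n + 1) := by
          simp [Fin.ext_iff]; omega
        have e2 : (⟨n + m + 2 - (i + 1), by omega⟩ : Fin (m + 2)) = Fin.last (m + 1) := by
          simp [Fin.ext_iff]; omega
        rw [e1, W.node_last] at h1
        rw [e2, X.node_last]
        exact h1
    · have h1 := (X.isLink ⟨n + m + 1 - i, by omega⟩).symm
      simp only [hi, dite_false]
      have e1 : (⟨n + m + 2 - i, by omega⟩ : Fin (m + 2)) = Fin.succ ⟨n + m + 1 - i, by omega⟩ := by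
        simp [Fin.ext_iff]; omega
      rw [e1]
      by_cases hl : (i : ℕ) = n + m + 1
      · have e2 : (Fin.castSucc ⟨n + m + 1 - i, by omega⟩ : Fin (m + 2)) = 0 := by
          simp [Fin.ext_iff]; omega
        have e3 : (i + 1 : Fin (n + m + 2)) = 0 := by
          simp [Fin.ext_iff, hval, hl]
        rw [e2, X.node_zero] at h1
        simpa [e3, W.node_zero] using h1
      · have hn : ¬ (i : ℕ) + 1 < n + 1 := by omega
        simp only [hval, hl, if_false, hn, dite_false]
        convert h1 using 2
        simp

theorem OpenPath.isCircle_union {u w : α} {n m : ℕ} (W : Γ.OpenPath u w n) (X : Γ.OpenPath u w m)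
    (hnode : range W.node ∩ range X.node = {u, w}) (hedge : Disjoint (range W.edge) (range X.edge)) :
    Γ.IsCircle (range W.edge ∪ range X.edge) := by
  refine ⟨n + m, W.closedPath X hnode hedge, ?_⟩
  ext x
  simp only [mem_range, mem_union, closedPath]
  constructor
  · rintro ⟨i, rfl⟩
    split_ifs
    exacts [Or.inl ⟨_, rfl⟩, Or.inr ⟨_, rfl⟩]
  · rintro (⟨i, rfl⟩ | ⟨i, rfl⟩)
    · exact ⟨⟨i, by omega⟩, dif_pos i.2⟩
    · refine ⟨⟨n + m + 1 - i, by omega⟩, ?_⟩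
      rw [dif_neg (by simp only; omega)]
      congr 1
      simp only [Fin.ext_iff]
      omega

/-- Removing suitable edges `f` and `g` of the second and third paths of a theta graph leaves a
circle-free set. -/
theorem IsTheta.exists_circleFree {A₁ A₂ A₃ : Set β} (h : Γ.IsTheta A₁ A₂ A₃) :
    ∃ f ∈ A₂, ∃ g ∈ A₃, Γ.CircleFree (A₁ ∪ (A₂ \ {f}) ∪ (A₃ \ {g})) := by
  obtain ⟨u, w, n₁, n₂, n₃, W₁, W₂, W₃, rfl, rfl, rfl, h12, h13, h23, -, -, -⟩ := h
  -- Without their last edges, the second and third paths hang on to the first only at `u`.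
  refine ⟨W₂.edge (Fin.last _), mem_range_self _, W₃.edge (Fin.last _), mem_range_self _, ?_⟩
  have key : ∀ {n m : ℕ} (W : Γ.OpenPath u w n) (X : Γ.OpenPath u w m),
      range X.node ∩ range W.node = {u, w} → ∀ i : Fin (n + 2), i ≠ 0 → (i : ℕ) ≤ n →
      ∀ j, ¬ Γ.Inc (X.edge j) (W.node i) := by
    intro n m W X hWX i h0 hi j hinc
    have hmem : W.node i ∈ range X.node := by
      rcases hinc.eq_or_eq_of_isLink (X.isLink j) with h | h <;> exact h ▸ mem_range_self _
    have : W.node i ∈ ({u, w} : Set α) := hWX ▸ ⟨hmem, mem_range_self i⟩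
    rcases this with h | h
    · exact h0 (W.eq_zero_of_node_eq h)
    · have := congrArg Fin.val (W.eq_last_of_node_eq h)
      simp only [Fin.val_last] at this
      omega
  have sub : ∀ {n : ℕ} (W : Γ.OpenPath u w n),
      range W.edge \ {W.edge (Fin.last n)} ⊆ W.edge '' {i | (i : ℕ) < n} := by
    rintro n W _ ⟨⟨i, rfl⟩, hi⟩
    exact ⟨i, Fin.lt_last_iff_ne_last.2 fun h => hi (by rw [h]; rfl), rfl⟩
  refine (W₃.circleFree_union (W₂.circleFree_union W₁.circleFree_range n₂ ?_) n₃ ?_).mono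
    (union_subset_union (union_subset_union_right _ (sub W₂)) (sub W₃))
  · rintro i h0 hi _ ⟨j, rfl⟩
    exact key W₂ W₁ h12 i h0 hi j
  · rintro i h0 hi _ (⟨j, rfl⟩ | ⟨j, -, rfl⟩)
    · exact key W₃ W₁ h13 i h0 hi j
    · exact key W₃ W₂ h23 i h0 hi j

end Graph

/-! ### The biased expansion, by projection from the apex. -/

namespace OrthographicFrame

variable {α : Type u₁} {β : Type u₂} {Δ : Graph α β} {P : Type u₃} (D : OrthographicFrame Δ P)

theorem z_ne_apex (e : Δ.edgeSet) : D.z e ≠ D.apex := fun h => D.apex_notMem (h ▸ D.z_mem e)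

theorem edgeLine_mem_lines (e : Δ.edgeSet) :
    D.edgeLine e ∈ D.geometry.lines ∧ D.z e ∈ D.edgeLine e ∧ D.apex ∈ D.edgeLine e := by
  obtain ⟨L, hL, hz, ha⟩ := D.geometry.exists_line (D.z_ne_apex e)
  have : D.edgeLine e = L := by
    ext x
    refine ⟨fun ⟨M, hM, h1, h2, h3⟩ => ?_, fun h => ⟨L, hL, hz, ha, h⟩⟩
    rwa [D.geometry.eq_of_mem_lines hL hM (D.z_ne_apex e) hz ha h1 h2]
  exact this ▸ ⟨hL, hz, ha⟩

theorem edgeLine_subset {t : Set P} (ht : D.geometry.IsSubspace t) {e : Δ.edgeSet} {x y : P}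
    (hx : x ∈ D.edgeLine e) (hy : y ∈ D.edgeLine e) (hxy : x ≠ y) (hxt : x ∈ t) (hyt : y ∈ t) :
    D.edgeLine e ⊆ t :=
  ht x hxt y hyt hxy _ (D.edgeLine_mem_lines e).1 hx hy

/-- A flat without the apex meets an edge line in at most one point. -/
theorem eq_of_mem_edgeLine {t : Set P} (ht : D.geometry.IsSubspace t) (hat : D.apex ∉ t)
    {e : Δ.edgeSet} {x y : P} (hx : x ∈ D.edgeLine e) (hy : y ∈ D.edgeLine e)
    (hxt : x ∈ t) (hyt : y ∈ t) : x = y := by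
  by_contra hxy
  exact hat (D.edgeLine_subset ht hx hy hxy hxt hyt (D.edgeLine_mem_lines e).2.2)

theorem circleFree_iff (S : Set Δ.edgeSet) :
    Δ.CircleFree (Subtype.val '' S) ↔ InjOn D.z S ∧ D.geometry.Independent (D.z '' S) :=
  D.represents S

/-- A point of the base that is in the join of the apex and a flat of the base is in the flat. -/
theorem mem_of_mem_span_insert_apex {t : Set P} (ht : D.geometry.IsSubspace t) (htb : t ⊆ D.base)
    {x : P} (hxb : x ∈ D.base) (hx : x ∈ D.geometry.span (insert D.apex t)) : x ∈ t := by
  have hxa : x ≠ D.apex := fun h => D.apex_notMem (h ▸ hxb)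
  obtain ⟨a, ha, L, hL, haL, hbL, hxL⟩ := D.geometry.exists_mem_line_of_mem_span_insert ht
    (fun h => D.apex_notMem (htb h)) hx hxa
  by_contra hxt
  have hax : a ≠ x := fun h => hxt (h ▸ ha)
  exact D.apex_notMem (D.isHyperplane.1 a (htb ha) x hxb hax L hL hbL hxL haL)

theorem z_mem_of_mem {t : Set P} (ht : D.geometry.IsSubspace t) (hat : D.apex ∈ t)
    {e : Δ.edgeSet} {x : P} (hx : x ∈ D.edgeLine e) (hxa : x ≠ D.apex) (hxt : x ∈ t) :
    D.z e ∈ t :=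
  D.edgeLine_subset ht hx (D.edgeLine_mem_lines e).2.2 hxa hxt hat (D.edgeLine_mem_lines e).2.1

variable [Δ.Simple]

/-- The set of edges of `Δ` to which the points of `T` project. -/
def projSet (T : Set P) : Set Δ.edgeSet := {e | ∃ x ∈ T, x ∈ D.edgeLine e}

theorem z_notMem_span {S : Set Δ.edgeSet} {e : Δ.edgeSet} (he : e ∉ S)
    (hS : Δ.CircleFree (Subtype.val '' insert e S)) : D.z e ∉ D.geometry.span (D.z '' S) := by
  have h := ((D.circleFree_iff _).1 hS).2.notMem_span (mem_image_of_mem _ (mem_insert e S))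
  refine fun h' => h (D.geometry.span_mono ?_ h')
  rintro _ ⟨f, hf, rfl⟩
  exact ⟨mem_image_of_mem _ (mem_insert_of_mem _ hf), fun hh => he (D.z_injective hh ▸ hf)⟩

/-- The removal of any edge makes a circle circle-free, so its image under `z` is a minimal
dependent set. -/
theorem z_mem_span_of_isCircle {C : Set β} (hC : Δ.IsCircle C) {e : Δ.edgeSet} (he : (e : β) ∈ C) :
    D.z e ∈ D.geometry.span (D.z '' {f | (f : β) ∈ C ∧ f ≠ e}) := by
  have hCval : Subtype.val '' {f : Δ.edgeSet | (f : β) ∈ C} = C := by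
    ext x
    exact ⟨fun ⟨f, hf, h⟩ => h ▸ hf, fun hx => ⟨⟨x, hC.subset_edgeSet hx⟩, hx, rfl⟩⟩
  have hdiff : ∀ f : Δ.edgeSet, D.z '' {g | (g : β) ∈ C} \ {D.z f} =
      D.z '' {g | (g : β) ∈ C ∧ g ≠ f} := by
    intro f
    ext x
    constructor
    · rintro ⟨⟨g, hg, rfl⟩, hgf⟩
      exact ⟨g, ⟨hg, fun h => hgf (h ▸ rfl)⟩, rfl⟩
    · rintro ⟨g, ⟨hg, hgf⟩, rfl⟩
      exact ⟨⟨g, hg, rfl⟩, fun h => hgf (D.z_injective h)⟩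
  rw [← hdiff]
  refine D.geometry.mem_span_diff_of_not_independent ?_ ?_ (mem_image_of_mem _ he)
  · intro h
    refine (D.circleFree_iff {f : Δ.edgeSet | (f : β) ∈ C}).2 ⟨D.z_injective.injOn, h⟩
      ⟨C, hC, hCval.ge⟩
  · rintro _ ⟨f, hf, rfl⟩
    rw [hdiff]
    refine ((D.circleFree_iff _).1 ((hC.circleFree_diff hf).mono ?_)).2
    rintro _ ⟨g, ⟨hg, hgf⟩, rfl⟩
    exact ⟨hg, fun h => hgf (Subtype.ext h)⟩

theorem proj_eq_iff (x : D.fullOmega.graph.edgeSet) (e : Δ.edgeSet) :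
    D.fullOmega.proj x = e ↔ (x : P) ∈ D.edgeLine e := by
  have h := D.mem_edgeLine_edgeProj _ Subset.rfl x
  exact ⟨fun he => he ▸ h, fun he => D.edgeLine_unique x.2.2 h he⟩

theorem mem_edgeLine_proj (x : D.fullOmega.graph.edgeSet) :
    (x : P) ∈ D.edgeLine (D.fullOmega.proj x) :=
  (D.proj_eq_iff x _).1 rfl

theorem mem_edgeSet_iff {x : P} :
    x ∈ D.fullOmega.graph.edgeSet ↔ (∃ e, x ∈ D.edgeLine e) ∧ x ≠ D.apex :=
  ⟨fun h => ⟨mem_iUnion.1 h.1, h.2⟩, fun h => ⟨mem_iUnion.2 h.1, h.2⟩⟩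

theorem fullOmega_isLink_iff {x : P} {u v : α} : D.fullOmega.graph.IsLink x u v ↔
    ∃ e : Δ.edgeSet, (x ∈ D.edgeLine e ∧ x ≠ D.apex) ∧ Δ.IsLink e u v :=
  ⟨fun ⟨hx, e, he, h⟩ => ⟨e, ⟨he, hx.2⟩, h⟩,
    fun ⟨e, ⟨he, hx⟩, h⟩ => ⟨⟨mem_iUnion.2 ⟨e, he⟩, hx⟩, e, he, h⟩⟩

theorem isLink_proj {x : D.fullOmega.graph.edgeSet} {u v : α}
    (h : D.fullOmega.graph.IsLink x u v) : Δ.IsLink (D.fullOmega.proj x) u v := by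
  obtain ⟨e, ⟨he, -⟩, h⟩ := D.fullOmega_isLink_iff.1 h
  rwa [(D.proj_eq_iff x e).2 he]

/-- The closed path over a closed path of `Δ` with given edges over the edges of the latter. -/
@[simps]
def liftClosedPath {n : ℕ} (W : Δ.ClosedPath n) (g : Fin (n + 2) → P)
    (hg : ∀ i, g i ∈ D.edgeLine ⟨W.edge i, W.edge_mem i⟩ ∧ g i ≠ D.apex) :
    D.fullOmega.graph.ClosedPath n where
  node := W.node
  edge := g
  node_injective := W.node_injective
  edge_injective i j h := W.edge_injective <| congrArg Subtype.val <|
    D.edgeLine_unique (hg i).2 (hg i).1 (h ▸ (hg j).1)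
  isLink i := D.fullOmega_isLink_iff.2 ⟨_, hg i, W.isLink i⟩

/-- A circle among the projected edges lifts to a circle in `T`: over each of its edges choose a
point of `T`. -/
theorem circleFree_projSet {T : Set P} (hT : T ⊆ D.fullOmega.graph.edgeSet)
    (h : D.fullOmega.graph.CircleFree T) : Δ.CircleFree (Subtype.val '' D.projSet T) := by
  rintro ⟨_, ⟨n, W, rfl⟩, hW⟩
  have : ∀ i, ∃ x ∈ T, x ∈ D.edgeLine ⟨W.edge i, W.edge_mem i⟩ := by
    intro i
    obtain ⟨e, ⟨x, hx, hxe⟩, he⟩ := hW (mem_range_self i)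
    refine ⟨x, hx, ?_⟩
    simpa only [← he] using hxe
  choose g hgT hg using this
  exact h ⟨range g, ⟨n, D.liftClosedPath W g fun i => ⟨hg i, (hT (hgT i)).2⟩, rfl⟩,
    range_subset_iff.2 hgT⟩

theorem isCircle_pair {x y : P} (hxy : x ≠ y) {e : Δ.edgeSet} (hx : x ∈ D.edgeLine e)
    (hy : y ∈ D.edgeLine e) (hxa : x ≠ D.apex) (hya : y ≠ D.apex) :
    D.fullOmega.graph.IsCircle {x, y} := by
  obtain ⟨u, v, h⟩ := Graph.exists_isLink_of_mem_edgeSet e.2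
  have hx := D.fullOmega_isLink_iff.2 ⟨e, ⟨hx, hxa⟩, h⟩
  have hy := D.fullOmega_isLink_iff.2 ⟨e, ⟨hy, hya⟩, h.symm⟩
  refine ⟨0, ⟨![u, v], ![x, y], ?_, ?_, ?_⟩, by simp [pair_comm]⟩
  · intro i j
    fin_cases i <;> fin_cases j <;> simp [h.ne, h.ne.symm]
  · intro i j
    fin_cases i <;> fin_cases j <;> simp [hxy, hxy.symm]
  · intro i
    fin_cases i
    exacts [hx, hy]

/-- A finite circle-free set of points spans a cross-flat. -/
theorem apex_notMem_span {T : Set P} (hfin : T.Finite) (hT : T ⊆ D.fullOmega.graph.edgeSet)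
    (h : D.fullOmega.graph.CircleFree T) : D.apex ∉ D.geometry.span T := by
  induction T, hfin using Set.Finite.induction_on with
  | empty => exact fun ha => D.geometry.span_subset (t := ∅) (by rintro p ⟨⟩) Subset.rfl ha
  | @insert x T hxT hfin ih =>
    intro ha
    obtain ⟨hxE, hTE⟩ := insert_subset_iff.1 hT
    -- Exchange puts `x` in the join of `T` and the apex; it remains to project this dependence to
    -- the base.
    have hx := D.geometry.mem_span_insert_exchange ha (ih hTE (h.mono (subset_insert _ _)))
    obtain ⟨⟨e, hxe⟩, hxa⟩ := D.mem_edgeSet_iff.1 hxE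
    -- Two points on the same edge line form a digon, which is a circle.
    have he : e ∉ D.projSet T := by
      rintro ⟨y, hyT, hye⟩
      exact h ⟨{x, y}, D.isCircle_pair (fun hxy => hxT (hxy ▸ hyT)) hxe hye hxa (hTE hyT).2,
        insert_subset_insert (singleton_subset_iff.2 hyT)⟩
    refine D.z_notMem_span (S := D.projSet T) he
      ((D.circleFree_projSet hT h).mono (image_mono (insert_subset ?_ ?_))) ?_
    · exact ⟨x, mem_insert _ _, hxe⟩
    · exact fun f ⟨y, hy, hyf⟩ => ⟨y, mem_insert_of_mem _ hy, hyf⟩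
    · refine D.mem_of_mem_span_insert_apex (D.geometry.isSubspace_span _)
        (D.geometry.span_subset D.isHyperplane.1 ?_) (D.z_mem e) ?_
      · rintro _ ⟨f, -, rfl⟩
        exact D.z_mem f
      · set t := D.geometry.span (insert D.apex (D.geometry.span (D.z '' D.projSet T)))
        have ht : D.geometry.IsSubspace t := D.geometry.isSubspace_span _
        have hat : D.apex ∈ t := D.geometry.subset_span _ (mem_insert _ _)
        refine D.z_mem_of_mem ht hat hxe hxa (D.geometry.span_subset ht (insert_subset hat ?_) hx)
        intro y hy
        obtain ⟨⟨f, hyf⟩, -⟩ := D.mem_edgeSet_iff.1 (hTE hy)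
        refine D.edgeLine_subset ht (D.edgeLine_mem_lines f).2.1 (D.edgeLine_mem_lines f).2.2
          (D.z_ne_apex f) ?_ hat hyf
        exact D.geometry.subset_span _ (mem_insert_of_mem _
          (D.geometry.subset_span _ ⟨f, ⟨y, hy, hyf⟩, rfl⟩))

/-- The join of `T` and the apex contains `z f` for the other edges `f` of `C`, hence also `z e`. As
a point of the cone over `span T`, `z e` is on a line through the apex and a point of `span T`, and
this line is the edge line. -/
theorem exists_mem_span_mem_edgeLine {C : Set β} (hC : Δ.IsCircle C) {e : Δ.edgeSet}
    (he : (e : β) ∈ C) {T : Set P} (hT : T ⊆ D.fullOmega.graph.edgeSet)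
    (hCT : {f : Δ.edgeSet | (f : β) ∈ C ∧ f ≠ e} ⊆ D.projSet T)
    (hat : D.apex ∉ D.geometry.span T) : ∃ x ∈ D.geometry.span T, x ∈ D.edgeLine e := by
  have hz : D.z e ∈ D.geometry.span (insert D.apex (D.geometry.span T)) := by
    refine D.geometry.span_subset_span ?_ (D.z_mem_span_of_isCircle hC he)
    rintro _ ⟨f, hf, rfl⟩
    obtain ⟨x, hx, hxf⟩ := hCT hf
    exact D.z_mem_of_mem (D.geometry.isSubspace_span _) (D.geometry.subset_span _ (mem_insert _ _))
      hxf (hT hx).2 (D.geometry.subset_span _ (mem_insert_of_mem _ (D.geometry.subset_span _ hx)))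
  obtain ⟨a, ha, L, hL, h1, h2, h3⟩ := D.geometry.exists_mem_line_of_mem_span_insert
    (D.geometry.isSubspace_span T) hat hz (D.z_ne_apex e)
  exact ⟨a, ha, L, hL, h3, h1, h2⟩

/-- The points other than `x` already span a flat that meets the edge line of `x`. The larger flat
`span C` misses the apex and so meets this line only in `x`; the two points agree. -/
theorem mem_span_diff_of_mem_balanced {C : Set P} (hC : C ∈ D.fullOmega.balanced) {x : P}
    (hx : x ∈ C) : x ∈ D.geometry.span (C \ {x}) := by
  have hCc := hC.1
  obtain ⟨⟨n, W, hW⟩, hat⟩ := hC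
  have hCE := hCc.subset_edgeSet
  have hinj : ∀ i j, D.fullOmega.proj ⟨W.edge i, W.edge_mem i⟩ =
      D.fullOmega.proj ⟨W.edge j, W.edge_mem j⟩ → i = j := fun i j h =>
    W.edge_injective <| D.eq_of_mem_edgeLine (D.geometry.isSubspace_span C) hat
      (D.mem_edgeLine_proj _) (h ▸ D.mem_edgeLine_proj ⟨W.edge j, W.edge_mem j⟩)
      (D.geometry.subset_span _ (hW ▸ mem_range_self i))
      (D.geometry.subset_span _ (hW ▸ mem_range_self j))
  -- Balance excludes two edges of `C` over one edge of Δ, so the closed path projects to a simple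
  -- one.
  let W' : Δ.ClosedPath n :=
    ⟨W.node, fun i => D.fullOmega.proj ⟨W.edge i, W.edge_mem i⟩, W.node_injective,
      fun i j h => hinj i j (Subtype.ext h), fun i => D.isLink_proj (W.isLink i)⟩
  obtain ⟨i, rfl⟩ : x ∈ range W.edge := hW ▸ hx
  have hxl := D.mem_edgeLine_proj ⟨W.edge i, W.edge_mem i⟩
  obtain ⟨y, hy, hye⟩ := D.exists_mem_span_mem_edgeLine (T := C \ {W.edge i})
    ⟨n, W', rfl⟩ (mem_range_self i) (sdiff_subset.trans hCE) (by
      rintro f ⟨⟨j, hj⟩, hne⟩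
      have hj : D.fullOmega.proj ⟨W.edge j, W.edge_mem j⟩ = f := Subtype.ext hj
      refine ⟨W.edge j, ⟨hW ▸ mem_range_self j, fun h => hne ?_⟩,
        (D.proj_eq_iff ⟨W.edge j, W.edge_mem j⟩ _).1 hj⟩
      rw [← hj, W.edge_injective h])
    (D.apex_notMem_span (hCc.finite.subset sdiff_subset) (sdiff_subset.trans hCE)
      (hCc.circleFree_diff hx))
  have hyx : y = W.edge i := D.eq_of_mem_edgeLine (D.geometry.isSubspace_span C) hat hye hxl
    (D.geometry.span_mono sdiff_subset hy) (D.geometry.subset_span _ hx)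
  exact hyx ▸ hy

theorem isBiasedGraph_fullOmega : D.fullOmega.IsBiasedGraph := by
  refine ⟨⟨fun x u h => ?_⟩, fun C hC => hC.1, fun A₁ A₂ A₃ hA h12 h13 => ⟨?_, fun ha => ?_⟩⟩
  · obtain ⟨e, -, he⟩ := D.fullOmega_isLink_iff.1 h
    exact he.ne rfl
  · obtain ⟨u, w, n₁, n₂, n₃, W₁, W₂, W₃, rfl, rfl, rfl, -, -, h23, -, -, hd⟩ := hA
    exact W₂.isCircle_union W₃ h23 hd
  -- The removed edges `f` and `g` are spanned by the rest of the balanced circles `A₁ ∪ A₂` and `A₁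
  -- ∪ A₃`, so the forest spans the whole theta graph.
  · obtain ⟨f, hf, g, hg, hfree⟩ := hA.exists_circleFree
    have h12E := h12.1.subset_edgeSet
    have h13E := h13.1.subset_edgeSet
    have hsub : A₁ ∪ (A₂ \ {f}) ∪ (A₃ \ {g}) ⊆ (A₁ ∪ A₂) ∪ (A₁ ∪ A₃) := by
      rintro x ((h | h) | h)
      exacts [Or.inl (Or.inl h), Or.inl (Or.inr h.1), Or.inr (Or.inr h.1)]
    refine D.apex_notMem_span ((h12.1.finite.union h13.1.finite).subset hsub)
      (hsub.trans (union_subset h12E h13E)) hfree (D.geometry.span_subset_span ?_ ha)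
    rintro x (hx | hx)
    · by_cases hxf : x = f
      · subst hxf
        refine D.geometry.span_mono ?_ (D.mem_span_diff_of_mem_balanced h12 (Or.inr hx))
        rintro y ⟨hy | hy, hne⟩
        exacts [Or.inl (Or.inl hy), Or.inl (Or.inr ⟨hy, hne⟩)]
      · exact D.geometry.subset_span _ (Or.inl (Or.inr ⟨hx, hxf⟩))
    · by_cases hxg : x = g
      · subst hxg
        refine D.geometry.span_mono ?_ (D.mem_span_diff_of_mem_balanced h13 (Or.inr hx))
        rintro y ⟨hy | hy, hne⟩
        exacts [Or.inl (Or.inl hy), Or.inr ⟨hy, hne⟩]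
      · exact D.geometry.subset_span _ (Or.inr ⟨hx, hxg⟩)

theorem isCircle_insert {C : Set β} (hC : Δ.IsCircle C) {e : Δ.edgeSet} (he : (e : β) ∈ C)
    {s : Δ.edgeSet → D.fullOmega.graph.edgeSet}
    (hs : ∀ f : Δ.edgeSet, (f : β) ∈ C → f ≠ e → D.fullOmega.proj (s f) = f)
    {x : P} (hx : x ∈ D.edgeLine e) (hxa : x ≠ D.apex) :
    D.fullOmega.graph.IsCircle
      (insert x ((fun f : Δ.edgeSet => (s f : P)) '' {f | (f : β) ∈ C ∧ f ≠ e})) := by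
  classical
  obtain ⟨n, W, rfl⟩ := hC
  refine ⟨n, D.liftClosedPath W (fun i => if W.edge i = e then x else s ⟨W.edge i, W.edge_mem i⟩)
    fun i => ?_, ?_⟩
  · split_ifs with h
    · have : (⟨W.edge i, W.edge_mem i⟩ : Δ.edgeSet) = e := Subtype.ext h
      rw [this]
      exact ⟨hx, hxa⟩
    · exact ⟨(D.proj_eq_iff _ _).1 (hs _ (mem_range_self i) fun hh => h (congrArg Subtype.val hh)),
        (s _).2.2⟩
  · ext y
    constructor
    · rintro ⟨i, rfl⟩
      rw [liftClosedPath_edge]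
      split_ifs with h
      · exact mem_insert _ _
      · exact Or.inr ⟨⟨W.edge i, W.edge_mem i⟩,
          ⟨mem_range_self i, fun hh => h (congrArg Subtype.val hh)⟩, rfl⟩
    · rintro (rfl | ⟨⟨f, hf⟩, ⟨⟨i, hi⟩, hne⟩, rfl⟩)
      · obtain ⟨i, hi⟩ := he
        exact ⟨i, if_pos hi⟩
      · subst hi
        exact ⟨i, if_neg fun h => hne (Subtype.ext h)⟩

theorem isBiasedExpansion_fullOmega : D.fullOmega.IsBiasedExpansion := by
  refine ⟨D.isBiasedGraph_fullOmega, rfl, fun x u v h => D.isLink_proj h, fun e => ?_, ?_⟩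
  · exact ⟨⟨D.z e, D.mem_edgeSet_iff.2 ⟨⟨e, (D.edgeLine_mem_lines e).2.1⟩, D.z_ne_apex e⟩⟩,
      (D.proj_eq_iff _ _).2 (D.edgeLine_mem_lines e).2.1⟩
  intro C hC e he s hs
  set T : Set P := (fun f : Δ.edgeSet => (s f : P)) '' {f | (f : β) ∈ C ∧ f ≠ e} with hTdef
  have hTE : T ⊆ D.fullOmega.graph.edgeSet := by
    rintro _ ⟨f, -, rfl⟩
    exact (s f).2
  have hz := D.isCircle_insert hC he hs (D.edgeLine_mem_lines e).2.1 (D.z_ne_apex e)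
  have hzT : D.z e ∉ T := by
    rintro ⟨f, ⟨hf, hfe⟩, hfz⟩
    refine hfe ((hs f hf hfe).symm.trans ((D.proj_eq_iff _ _).2 ?_))
    have hfz : (s f : P) = D.z e := hfz
    rw [hfz]
    exact (D.edgeLine_mem_lines e).2.1
  have hat : D.apex ∉ D.geometry.span T := by
    refine D.apex_notMem_span (hz.finite.subset (subset_insert _ _)) hTE
      ((hz.circleFree_diff (mem_insert _ _)).mono fun y hy => ?_)
    exact ⟨mem_insert_of_mem _ hy, fun h => hzT (h ▸ hy)⟩
  obtain ⟨x, hx, hxe⟩ := D.exists_mem_span_mem_edgeLine hC he hTE (by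
    rintro f ⟨hf, hfe⟩
    exact ⟨s f, ⟨f, ⟨hf, hfe⟩, rfl⟩, (D.proj_eq_iff _ _).1 (hs f hf hfe)⟩) hat
  have hxa : x ≠ D.apex := fun h => hat (h ▸ hx)
  refine ⟨⟨x, D.mem_edgeSet_iff.2 ⟨⟨e, hxe⟩, hxa⟩⟩, ⟨(D.proj_eq_iff _ _).2 hxe,
    D.isCircle_insert hC he hs hxe hxa, fun h => hat ?_⟩, ?_⟩
  · exact D.geometry.span_subset_span (insert_subset hx (D.geometry.subset_span _)) h
  · rintro y ⟨hye, -, hya⟩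
    rw [proj_eq_iff] at hye
    refine Subtype.ext (D.eq_of_mem_edgeLine (D.geometry.isSubspace_span _) hya hye hxe
      (D.geometry.subset_span _ (mem_insert _ _)) ?_)
    exact D.geometry.span_mono (subset_insert _ _) hx

end OrthographicFrame

/-! ### Potentials for gains in a possibly nonabelian group. -/

namespace SimpleGraph

variable {α : Type u₁} {H : SimpleGraph α} {M : Type u₃} [Group M] (s : α → α → M)

/-- The gain of a walk, where `s u w` is the gain of the step from `u` to `w`. -/
def walkGain : ∀ {u w : α}, H.Walk u w → M
  | _, _, .nil => 1
  | _, _, .cons (u := u) (v := v) _ p => walkGain p * s u v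

theorem walkGain_append {u v w : α} (p : H.Walk u v) (q : H.Walk v w) :
    walkGain s (p.append q) = walkGain s q * walkGain s p := by
  induction p with
  | nil => simp [walkGain]
  | cons h p ih => simp [walkGain, ih, mul_assoc]

theorem walkGain_reverse (hs : ∀ u w, H.Adj u w → s w u * s u w = 1) {u w : α} (p : H.Walk u w) :
    walkGain s p.reverse = (walkGain s p)⁻¹ := by
  induction p with
  | nil => simp [walkGain]
  | cons h p ih =>
    simp [walkGain, walkGain_append, ih, eq_inv_of_mul_eq_one_left (hs _ _ h)]

/-- The product telescopes. A sequence `d` with equal end values thus certifies a trivial gain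
without an ordered product over the indices of a closed path. -/
theorem walkGain_eq_of_forall {u w : α} (p : H.Walk u w) (d : ℕ → M)
    (hd : ∀ i < p.length, s (p.getVert i) (p.getVert (i + 1)) = (d (i + 1))⁻¹ * d i) :
    walkGain s p = (d p.length)⁻¹ * d 0 := by
  induction p generalizing d with
  | nil => simp [walkGain]
  | cons h p ih =>
    have h0 := hd 0 (by simp)
    have := ih (fun i => d (i + 1)) fun i hi => by simpa using hd (i + 1) (by simpa using hi)
    simp only [Walk.getVert_zero, Walk.getVert_cons_succ] at h0
    simp [walkGain, this, h0]

/-- Each detour cut out by `bypass` is either a step and its reverse or a cycle, and has trivial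
gain. -/
theorem walkGain_bypass [DecidableEq α] (hs : ∀ u w, H.Adj u w → s w u * s u w = 1)
    (hc : ∀ (u : α) (p : H.Walk u u), p.IsCycle → walkGain s p = 1) {u w : α} (p : H.Walk u w) :
    walkGain s p.bypass = walkGain s p := by
  induction p with
  | nil => rfl
  | @cons u v w h p ih =>
    rw [Walk.bypass]
    split_ifs with hmem
    · rw [walkGain, ← ih]
      conv_rhs => rw [← p.bypass.take_spec hmem, walkGain_append]
      have hpath := p.bypass_isPath.takeUntil hmem
      set q := p.bypass.takeUntil u hmem with hq
      suffices walkGain s q * s u v = 1 by rw [mul_assoc, this, mul_one]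
      -- If the path `q` from `v` to `u` uses the edge `uv`, it is that edge alone; otherwise `uv`
      -- closes it to a cycle.
      by_cases he : s(u, v) ∈ q.edges
      · have hq' : q = Walk.cons h.symm Walk.nil := by
          cases hq2 : q with
          | nil => exact absurd rfl h.ne
          | @cons _ x _ h' r =>
            rw [hq2] at hpath he
            rw [Walk.cons_isPath_iff] at hpath
            rw [Walk.edges_cons, List.mem_cons] at he
            rcases he with he | he
            · rw [Sym2.eq_swap, Sym2.eq_iff] at he
              obtain ⟨-, rfl⟩ | ⟨rfl, -⟩ := he
              · rw [(Walk.isPath_iff_nil.1 hpath.1).eq_nil]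
              · exact absurd rfl h'.ne
            · exact absurd (r.snd_mem_support_of_mem_edges he) hpath.2
        rw [hq']
        simpa [walkGain] using hs u v h
      · exact hc u (Walk.cons h q) ((Walk.cons_isCycle_iff q h).2 ⟨hpath, he⟩)
    · rw [walkGain, walkGain, ih]

/-- Gains that are trivial on all cycles come from a potential. -/
theorem exists_potential (hs : ∀ u w, H.Adj u w → s w u * s u w = 1)
    (hc : ∀ (u : α) (p : H.Walk u u), p.IsCycle → walkGain s p = 1) :
    ∃ η : α → M, ∀ u w, H.Adj u w → η w = s u w * η u := by
  classical
  have hclosed : ∀ (u : α) (p : H.Walk u u), walkGain s p = 1 := by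
    intro u p
    rw [← walkGain_bypass s hs hc, (Walk.isPath_iff_nil.1 p.bypass_isPath).eq_nil, walkGain]
  have hpq : ∀ {u w : α} (p q : H.Walk u w), walkGain s p = walkGain s q := by
    intro u w p q
    have := hclosed u (p.append q.reverse)
    rw [walkGain_append, walkGain_reverse s hs] at this
    exact (inv_mul_eq_one.1 this).symm
  have hroot : ∀ c : H.ConnectedComponent, ∃ r, H.connectedComponentMk r = c := fun c => c.exists_rep
  choose root hroot using hroot
  have hreach : ∀ v, H.Reachable (root (H.connectedComponentMk v)) v := fun v =>
    ConnectedComponent.exact (hroot _)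
  refine ⟨fun v => walkGain s (hreach v).some, fun u w h => ?_⟩
  have huw : H.connectedComponentMk w = H.connectedComponentMk u :=
    ConnectedComponent.sound h.reachable.symm
  -- The start `r` is kept variable, because the root of the component of `w` equals that of `u`
  -- only by a proved equation.
  have key : ∀ r (q : H.Walk r w), r = root (H.connectedComponentMk u) →
      walkGain s q = s u w * walkGain s (hreach u).some := by
    rintro r q rfl
    rw [hpq q ((hreach u).some.append (Walk.cons h Walk.nil)), walkGain_append]
    simp [walkGain]
  exact key _ _ (by rw [huw])

end SimpleGraph

namespace Graph

variable {α : Type u₁} {β : Type u₂} {Δ : Graph α β} [Δ.Simple]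

/-- The adjacency relation of a loopless graph. -/
def adjGraph (Δ : Graph α β) [Δ.Simple] : SimpleGraph α where
  Adj := Δ.Adj
  symm := ⟨fun _ _ h => h.symm⟩
  loopless := ⟨fun u h => Δ.not_adj_self u h⟩

theorem exists_closedPath_of_isCycle {u : α} {p : Δ.adjGraph.Walk u u} (hp : p.IsCycle) :
    ∃ (n : ℕ) (W : Δ.ClosedPath n), p.length = n + 2 ∧ (∀ i, W.node i = p.getVert i) ∧
      ∀ i, W.node (i + 1) = p.getVert (i + 1) := by
  obtain ⟨n, hn⟩ := Nat.exists_eq_add_of_le' hp.three_le_length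
  have hadj : ∀ i : Fin (n + 1 + 2), Δ.Adj (p.getVert i) (p.getVert (i + 1)) := fun i =>
    p.adj_getVert_succ (by omega)
  choose e he using hadj
  have hnext : ∀ i : Fin (n + 1 + 2), p.getVert ((i + 1 : Fin (n + 1 + 2)) : ℕ) =
      p.getVert (i + 1) := by
    intro i
    rw [Fin.val_add_one]
    split_ifs with h
    · rw [h, Fin.val_last, p.getVert_zero, ← hn, p.getVert_length]
    · rfl
  have hinj : Function.Injective fun i : Fin (n + 1 + 2) => p.getVert i := by
    intro i j h
    exact Fin.ext (hp.getVert_injOn' (by simp; omega) (by simp; omega) h)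
  refine ⟨n + 1, ⟨fun i => p.getVert i, e, hinj, fun i j h => ?_, fun i => ?_⟩, hn,
    fun _ => rfl, hnext⟩
  · rcases (he i).eq_and_eq_or_eq_and_eq (h ▸ he j) with ⟨h1, -⟩ | ⟨h1, h2⟩
    · exact hinj h1
    -- The edge used in both directions would force `i = j + 1` and `j = i + 1`, which is impossible
    -- modulo a length of at least 3.
    · rw [← hnext] at h1 h2
      have h1 : i = j + 1 := hinj h1
      have h2 : i + 1 = j := hinj h2
      have h1 := congrArg Fin.val h1
      have h2 := congrArg Fin.val h2
      rw [Fin.val_add_one] at h1 h2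
      simp only [Fin.ext_iff, Fin.val_last] at h1 h2 ⊢
      split_ifs at h1 h2 <;> omega
  · rw [hnext]
    exact he i

/-- Gains that are trivial on all closed paths come from a potential. -/
theorem exists_potential {M : Type u₃} [Group M] (s : α → α → M)
    (hs : ∀ u w, Δ.Adj u w → s w u * s u w = 1)
    (hc : ∀ (n : ℕ) (W : Δ.ClosedPath n), ∃ d : ℕ → M, d (n + 2) = d 0 ∧
      ∀ i : Fin (n + 2), s (W.node i) (W.node (i + 1)) = (d (i + 1))⁻¹ * d i) :
    ∃ η : α → M, ∀ u w, Δ.Adj u w → η w = s u w * η u := by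
  refine SimpleGraph.exists_potential (H := Δ.adjGraph) s hs fun u p hp => ?_
  obtain ⟨n, W, hn, h1, h2⟩ := exists_closedPath_of_isCycle hp
  obtain ⟨d, hd, h⟩ := hc n W
  rw [SimpleGraph.walkGain_eq_of_forall s p d, hn, hd, inv_mul_cancel]
  intro i hi
  have := h ⟨i, hn ▸ hi⟩
  rwa [h1, h2] at this

end Graph

/-! ### Linear representations of a graphic matroid as differences on the nodes. -/

open scoped Fin.CommRing in
theorem Fin.forall_of_add_one {n : ℕ} {p : Fin (n + 1) → Prop} (h : ∀ i, p i → p (i + 1))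
    {i : Fin (n + 1)} (hi : p i) (j : Fin (n + 1)) : p j := by
  have key : ∀ k : ℕ, p (i + (k : Fin (n + 1))) := by
    intro k
    induction k with
    | zero => simpa using hi
    | succ k ih => simpa [add_assoc] using h _ ih
  simpa using key (j - i : Fin (n + 1)).val

/-- Nonzero vectors can be measured by scalars so that proportional vectors have proportional
measures. -/
theorem exists_scalar_of_proportional (F : Type u₁) (Q : Type u₂) [DivisionRing F] [AddCommGroup Q]
    [Module F Q] : ∃ a : Q → F, (∀ q, q ≠ 0 → a q ≠ 0) ∧ ∀ q q' : Q, q ≠ 0 → q' ≠ 0 →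
      ∀ c c' : F, c • q + c' • q' = 0 → c * a q + c' * a q' = 0 := by
  have : ∀ q : Q, ∃ a : F, ∀ h : q ≠ 0, a ≠ 0 ∧ q = a • (Projectivization.mk F q h).rep := by
    intro q
    by_cases h : q = 0
    · exact ⟨0, fun h' => absurd h h'⟩
    · obtain ⟨a, ha⟩ := Projectivization.exists_smul_eq_mk_rep F q h
      refine ⟨(a⁻¹ : Fˣ), fun h => ⟨Units.ne_zero _, ?_⟩⟩
      rw [← ha, ← Units.smul_def, inv_smul_smul]
  choose a ha using this
  refine ⟨a, fun q h => (ha q h).1, fun q q' h h' c c' hc => ?_⟩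
  by_cases hc0 : c = 0
  · subst hc0
    rw [zero_smul, zero_add, smul_eq_zero] at hc
    simp [hc.resolve_right h']
  have hq : (-(c⁻¹ * c')) • q' = q := by
    rw [neg_smul, mul_smul, ← smul_neg, ← eq_neg_of_add_eq_zero_left hc, inv_smul_smul₀ hc0]
  -- Proportional vectors have the same chosen representative, and `a` measures each vector by its
  -- multiple of that.
  have hmk : Projectivization.mk F q h = Projectivization.mk F q' h' :=
    (Projectivization.mk_eq_mk_iff' F _ _ h h').2 ⟨_, hq⟩
  have h1 := (ha q h).2
  have h2 := (ha q' h').2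
  rw [hmk] at h1
  have h3 : (c * a q + c' * a q') • (Projectivization.mk F q' h').rep = 0 := by
    rw [add_smul, mul_smul, mul_smul, ← h1, ← h2, hc]
  exact (smul_eq_zero.1 h3).resolve_right (Projectivization.rep_nonzero _)

namespace Graph

variable {α : Type u₁} {β : Type u₂} {Δ : Graph α β}

/-- The edges of a closed path, as elements of the edge set. -/
def ClosedPath.toEdge {n : ℕ} (W : Δ.ClosedPath n) (i : Fin (n + 2)) : Δ.edgeSet :=
  ⟨W.edge i, W.edge_mem i⟩

theorem ClosedPath.toEdge_injective {n : ℕ} (W : Δ.ClosedPath n) : Function.Injective W.toEdge :=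
  fun _ _ h => W.edge_injective (congrArg Subtype.val h)

section Representation

variable {F : Type u₃} {V : Type u₄} [DivisionRing F] [AddCommGroup V] [Module F V]
  {v : Δ.edgeSet → V} (hv : ∀ S : Set Δ.edgeSet, Δ.CircleFree (Subtype.val '' S) ↔ LinearIndepOn F v S)

include hv

/-- A maximal independent set of edges away from `x` is a forest with the same span, and an edge at
`x` can be added to it without making a circle. -/
theorem notMem_span_of_inc {e : Δ.edgeSet} {x : α} (he : Δ.Inc e x) :
    v e ∉ Submodule.span F (v '' {f | ¬ Δ.Inc f x}) := by
  have h0 := linearIndepOn_empty F v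
  set B := h0.extend (empty_subset {f : Δ.edgeSet | ¬ Δ.Inc f x}) with hB
  have hBN : B ⊆ {f : Δ.edgeSet | ¬ Δ.Inc f x} := h0.extend_subset _
  have hBi : LinearIndepOn F v B := h0.linearIndepOn_extend _
  rw [← h0.span_image_extend_eq_span_image (empty_subset {f : Δ.edgeSet | ¬ Δ.Inc f x}), ← hB]
  refine ((linearIndepOn_insert fun h => hBN h he).1 ((hv _).1 ?_)).2
  rw [image_insert_eq]
  refine ((hv B).2 hBi).insert_of_inc ?_ he
  rintro _ ⟨f, hf, rfl⟩
  exact hBN hf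

theorem ClosedPath.exists_relation {n : ℕ} (W : Δ.ClosedPath n) :
    ∃ c : Fin (n + 2) → F, ∑ i, c i • v (W.toEdge i) = 0 ∧ ∃ i, c i ≠ 0 := by
  rw [← Fintype.not_linearIndependent_iff]
  intro h
  refine (hv (range W.toEdge)).2 ((linearIndepOn_range_iff W.toEdge_injective v).2 h)
    ⟨_, ⟨n, W, rfl⟩, ?_⟩
  rintro _ ⟨i, rfl⟩
  exact ⟨W.toEdge i, mem_range_self i, rfl⟩

/-- The ratio of the coefficients of adjacent edges in a relation around a circle does not depend on
the circle. -/
theorem exists_local_coefficients : ∃ a : Δ.edgeSet → α → F,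
    (∀ (e : Δ.edgeSet) x, Δ.Inc e x → a e x ≠ 0) ∧
    ∀ (n : ℕ) (W : Δ.ClosedPath n) (c : Fin (n + 2) → F), ∑ i, c i • v (W.toEdge i) = 0 →
      ∀ i, c i * a (W.toEdge i) (W.node (i + 1)) +
        c (i + 1) * a (W.toEdge (i + 1)) (W.node (i + 1)) = 0 := by
  let N : α → Submodule F V := fun x => Submodule.span F (v '' {f | ¬ Δ.Inc f x})
  choose a ha hac using fun x => exists_scalar_of_proportional F (V ⧸ N x)
  have hN : ∀ {e : Δ.edgeSet} {x : α}, Δ.Inc e x → (N x).mkQ (v e) ≠ 0 := fun he h =>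
    notMem_span_of_inc hv he ((Submodule.Quotient.mk_eq_zero _).1 h)
  refine ⟨fun e x => a x ((N x).mkQ (v e)), fun e x he => ha x _ (hN he),
    fun n W c hc i => hac _ _ _ (hN (W.inc_right i)) (hN (W.inc_left (i + 1))) _ _ ?_⟩
  -- Modulo the edges away from this node, only the two edges of the circle at the node remain.
  have h := congrArg (N (W.node (i + 1))).mkQ hc
  rw [map_sum, map_zero, Fintype.sum_eq_add i (i + 1) (by simp)] at h
  · simpa using h
  · rintro j ⟨hji, hji'⟩
    rw [map_smul]
    refine smul_eq_zero_of_right _ ((Submodule.Quotient.mk_eq_zero _).2 ?_)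
    refine Submodule.subset_span ⟨_, fun hinc => ?_, rfl⟩
    rcases W.eq_or_eq_of_inc hinc with h | h
    · exact hji' h.symm
    · exact hji (add_right_cancel h).symm

/-- There are no scalars `0` in a nontrivial relation around a circle. -/
theorem ClosedPath.exists_relation_ne_zero {n : ℕ} (W : Δ.ClosedPath n) :
    ∃ c : Fin (n + 2) → F, ∑ i, c i • v (W.toEdge i) = 0 ∧ ∀ i, c i ≠ 0 := by
  obtain ⟨a, ha, hac⟩ := exists_local_coefficients hv
  obtain ⟨c, hc, j, hj⟩ := W.exists_relation hv
  refine ⟨c, hc, fun i hi => hj (Fin.forall_of_add_one (p := fun i => c i = 0) ?_ hi j)⟩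
  intro i hi
  have := hac n W c hc i
  rw [hi, zero_mul, zero_add, mul_eq_zero] at this
  exact this.resolve_right (ha _ _ (W.inc_left _))

variable [Δ.Simple]

open scoped Fin.CommRing in
/-- The local coefficients can be scaled to be opposite at the two ends of each edge. -/
theorem exists_coefficients_opposite : ∃ μ : Δ.edgeSet → α → F,
    (∀ (e : Δ.edgeSet) x, Δ.Inc e x → μ e x ≠ 0) ∧
    (∀ (e : Δ.edgeSet) u w, Δ.IsLink e u w → μ e w = - μ e u) ∧
    ∀ (n : ℕ) (W : Δ.ClosedPath n) (c : Fin (n + 2) → F), ∑ i, c i • v (W.toEdge i) = 0 →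
      ∀ i, c i * μ (W.toEdge i) (W.node (i + 1)) +
        c (i + 1) * μ (W.toEdge (i + 1)) (W.node (i + 1)) = 0 := by
  obtain ⟨a, ha, hac⟩ := exists_local_coefficients hv
  have hstep : ∀ u w, ∃ s : Fˣ, ∀ e : Δ.edgeSet, Δ.IsLink e u w →
      (s : F) = -((a e w)⁻¹ * a e u) := by
    intro u w
    by_cases h : ∃ e : Δ.edgeSet, Δ.IsLink e u w
    · obtain ⟨e, he⟩ := h
      refine ⟨Units.mk0 (-((a e w)⁻¹ * a e u)) (neg_ne_zero.2 (mul_ne_zero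
        (inv_ne_zero (ha _ _ he.inc_right)) (ha _ _ he.inc_left))), fun f hf => ?_⟩
      obtain rfl : e = f := Subtype.ext (he.eq hf)
      rfl
    · exact ⟨1, fun e he => absurd ⟨e, he⟩ h⟩
  choose s hs using hstep
  obtain ⟨η, hη⟩ := exists_potential (Δ := Δ) s
    (by
      rintro u w ⟨e, he⟩
      have h1 := ha ⟨e, he.edge_mem⟩ u he.inc_left
      have h2 := ha ⟨e, he.edge_mem⟩ w he.inc_right
      ext
      rw [Units.val_mul, hs w u ⟨e, he.edge_mem⟩ he.symm, hs u w ⟨e, he.edge_mem⟩ he]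
      simp [mul_assoc, h1, h2])
    (by
      intro n W
      obtain ⟨c, hc, hc0⟩ := W.exists_relation_ne_zero hv
      -- The local relation at node `i + 1` turns the step `-(a e w)⁻¹ * a e u` into a quotient of
      -- consecutive values of `c k * a`, with each edge taken at its first node.
      refine ⟨fun k => Units.mk0 (c k * a (W.toEdge k) (W.node k))
        (mul_ne_zero (hc0 _) (ha _ _ (W.inc_left _))), by simp, fun i => ?_⟩
      ext
      rw [Units.val_mul, hs _ _ (W.toEdge i) (W.isLink i), Units.val_inv_eq_inv_val]
      have h := eq_neg_of_add_eq_zero_right (hac n W c hc i)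
      have h1 := hc0 i
      simp [h, mul_inv_rev, mul_assoc, h1])
  refine ⟨fun e x => a e x * η x, fun e x he => mul_ne_zero (ha e x he) (Units.ne_zero _),
    fun e u w he => ?_, fun n W c hc i => ?_⟩
  · have h2 := ha e w he.inc_right
    beta_reduce
    rw [hη u w he.adj, Units.val_mul, hs u w e he]
    simp [← mul_assoc, h2]
  · rw [← mul_assoc, ← mul_assoc, ← add_mul, hac n W c hc i, zero_mul]

open scoped Fin.CommRing in
/-- A linear representation of the graphic matroid is, up to scaling, given by the differences of a
vector-valued function on the nodes. -/
theorem exists_vector_potential : ∃ θ : α → V, ∀ (e : Δ.edgeSet) u w, Δ.IsLink e u w →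
    ∃ c : F, c ≠ 0 ∧ θ w - θ u = c • v e := by
  obtain ⟨μ, hμ0, hμ, hμc⟩ := exists_coefficients_opposite hv
  have hstep : ∀ u w, ∃ b : V, ∀ e : Δ.edgeSet, Δ.IsLink e u w → b = (μ e w)⁻¹ • v e := by
    intro u w
    by_cases h : ∃ e : Δ.edgeSet, Δ.IsLink e u w
    · obtain ⟨e, he⟩ := h
      refine ⟨(μ e w)⁻¹ • v e, fun f hf => ?_⟩
      obtain rfl : e = f := Subtype.ext (he.eq hf)
      rfl
    · exact ⟨0, fun e he => absurd ⟨e, he⟩ h⟩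
  choose b hb using hstep
  obtain ⟨θ, hθ⟩ := exists_potential (Δ := Δ) (fun u w => Multiplicative.ofAdd (b u w))
    (by
      rintro u w ⟨e, he⟩
      rw [hb w u ⟨e, he.edge_mem⟩ he.symm, hb u w ⟨e, he.edge_mem⟩ he, ← ofAdd_add, ofAdd_eq_one,
        hμ ⟨e, he.edge_mem⟩ u w he]
      simp [inv_neg])
    (by
      intro n W
      obtain ⟨c, hc, hc0⟩ := W.exists_relation_ne_zero hv
      have hsum : ∑ i, b (W.node i) (W.node (i + 1)) = 0 := by
        -- Since `μ` changes sign along an edge, the local relations make this product constant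
        -- around the circle. The constant times the sum of the `b`'s is the given relation.
        have hconst : ∀ i, c i * μ (W.toEdge i) (W.node (i + 1)) =
            c 0 * μ (W.toEdge 0) (W.node (0 + 1)) := by
          refine Fin.forall_of_add_one (fun i hi => ?_) (i := 0) rfl
          have h := eq_neg_of_add_eq_zero_left (hμc n W c hc i)
          rw [← hi, h, hμ _ _ _ (W.isLink (i + 1)), mul_neg]
        have hne : c 0 * μ (W.toEdge 0) (W.node (0 + 1)) ≠ 0 :=
          mul_ne_zero (hc0 0) (hμ0 _ _ (W.inc_right 0))
        refine (smul_eq_zero.1 ?_).resolve_left hne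
        rw [Finset.smul_sum, ← hc]
        refine Finset.sum_congr rfl fun i _ => ?_
        rw [hb _ _ (W.toEdge i) (W.isLink i), ← hconst i, smul_smul,
          mul_inv_cancel_right₀ (hμ0 _ _ (W.inc_right i))]
      -- The sign is due to the form `(d (i + 1))⁻¹ * d i`: the negated partial sums differ in the
      -- right direction.
      refine ⟨fun k => Multiplicative.ofAdd (-∑ j ∈ Finset.range k,
        b (W.node (j : ℕ)) (W.node ((j : ℕ) + 1))), ?_, fun i => ?_⟩
      · simp [Finset.sum_range, hsum]
      · rw [← ofAdd_neg, ← ofAdd_add, Finset.sum_range_succ]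
        simp)
  refine ⟨fun x => (θ x).toAdd, fun e u w he => ⟨(μ e w)⁻¹, inv_ne_zero (hμ0 _ _ he.inc_right), ?_⟩⟩
  beta_reduce
  rw [hθ u w he.adj, toAdd_mul, toAdd_ofAdd, add_sub_cancel_right, hb u w e he]

end Representation

end Graph

/-! ### Linear forms from scalar functions on the nodes. -/

theorem LinearIndepOn.exists_linearMap {ι : Type u₁} {F : Type u₂} {V : Type u₃} [DivisionRing F]
    [AddCommGroup V] [Module F V] {v : ι → V} {B : Set ι} (hB : LinearIndepOn F v B) (t : ι → F) :
    ∃ l : V →ₗ[F] F, ∀ b ∈ B, l (v b) = t b := by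
  have hB' : LinearIndependent F fun b : B => v b := hB
  let f := (Module.Basis.span hB').constr ℕ fun b : B => t b
  obtain ⟨l, hl⟩ := LinearMap.exists_extend f
  refine ⟨l, fun b hb => ?_⟩
  have h1 := LinearMap.congr_fun hl (Module.Basis.span hB' ⟨b, hb⟩)
  have h2 := Module.Basis.constr_basis (Module.Basis.span hB') ℕ (fun b : B => t b) ⟨b, hb⟩
  rw [← h2]
  refine Eq.trans ?_ h1
  rw [LinearMap.comp_apply, Submodule.subtype_apply, Module.Basis.span_apply]

theorem Fin.sum_add_one_sub {n : ℕ} {M : Type u₁} [AddCommGroup M] (f : Fin (n + 1) → M) :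
    ∑ i, (f (i + 1) - f i) = 0 := by
  rw [Finset.sum_sub_distrib, sub_eq_zero]
  exact Equiv.sum_comp (Equiv.addRight (1 : Fin (n + 1))) f

namespace Graph

variable {α : Type u₁} {β : Type u₂} {Δ : Graph α β}

theorem apply_sub_of_isLink {F V : Type*} [DivisionRing F] [AddCommGroup V] [Module F V]
    {θ : α → V} {k : α → F} {l : V →ₗ[F] F} {e : β} {u w x y : α} (h : Δ.IsLink e u w)
    (h' : Δ.IsLink e x y) (hl : l (θ w - θ u) = k w - k u) : l (θ y - θ x) = k y - k x := by
  rcases h.eq_and_eq_or_eq_and_eq h' with ⟨rfl, rfl⟩ | ⟨rfl, rfl⟩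
  · exact hl
  · rw [← neg_sub (θ w), map_neg, hl, neg_sub]

/-- The differences of a scalar function on the nodes are the values of a linear form at the
vectors of a representation of the graphic matroid. -/
theorem exists_linearMap_of_potential {F : Type u₃} {V : Type u₄} [DivisionRing F] [AddCommGroup V]
    [Module F V] {v : Δ.edgeSet → V}
    (hv : ∀ S : Set Δ.edgeSet, Δ.CircleFree (Subtype.val '' S) ↔ LinearIndepOn F v S)
    {θ : α → V} (hθ : ∀ (e : Δ.edgeSet) u w, Δ.IsLink e u w → ∃ c : F, c ≠ 0 ∧ θ w - θ u = c • v e)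
    (k : α → F) :
    ∃ l : V →ₗ[F] F, ∀ (e : Δ.edgeSet) u w, Δ.IsLink e u w → l (θ w - θ u) = k w - k u := by
  choose x y hxy using fun e : Δ.edgeSet => exists_isLink_of_mem_edgeSet e.2
  choose c hc0 hc using fun e : Δ.edgeSet => hθ e _ _ (hxy e)
  have h0 := linearIndepOn_empty F v
  -- `B` is a maximal forest. The form is prescribed on it, and any other edge closes a circle with
  -- edges of `B`.
  have hB : LinearIndepOn F v (h0.extend (empty_subset univ)) := h0.linearIndepOn_extend _
  have hspan := h0.image_subset_span_image_extend (empty_subset univ)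
  set B := h0.extend (empty_subset univ)
  obtain ⟨l, hl⟩ := hB.exists_linearMap fun e => (c e)⁻¹ * (k (y e) - k (x e))
  have hlB : ∀ e ∈ B, ∀ u w, Δ.IsLink e u w → l (θ w - θ u) = k w - k u := fun e he u w h =>
    apply_sub_of_isLink (hxy e) h (by
      rw [hc e, map_smul, hl e he, smul_eq_mul, mul_inv_cancel_left₀ (hc0 e)])
  refine ⟨l, fun e u w h => ?_⟩
  by_cases he : e ∈ B
  · exact hlB e he u w h
  have hdep : ¬ Δ.CircleFree (Subtype.val '' insert e B) := by
    rw [hv, linearIndepOn_insert he]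
    exact fun h => h.2 (hspan (mem_image_of_mem _ (mem_univ e)))
  obtain ⟨_, ⟨n, W, rfl⟩, hW⟩ := not_not.1 hdep
  have hWB : ∀ i, W.toEdge i = e ∨ W.toEdge i ∈ B := by
    intro i
    obtain ⟨f, hf, hfi⟩ := hW (mem_range_self i)
    obtain rfl : f = W.toEdge i := Subtype.ext hfi
    exact hf
  obtain ⟨j, hj⟩ : ∃ j, W.toEdge j = e := by
    by_contra hne
    push Not at hne
    refine (hv B).2 hB ⟨_, ⟨n, W, rfl⟩, ?_⟩
    rintro _ ⟨i, rfl⟩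
    exact ⟨W.toEdge i, (hWB i).resolve_left (hne i), rfl⟩
  subst hj
  refine apply_sub_of_isLink (W.isLink j) h ?_
  -- Both kinds of differences telescope to zero around the circle, and all terms but that of `e`
  -- are zero by the choice of `l` on `B`.
  have hsum : ∑ i, (l (θ (W.node (i + 1)) - θ (W.node i)) -
      (k (W.node (i + 1)) - k (W.node i))) = 0 := by
    rw [Finset.sum_sub_distrib, ← map_sum, Fin.sum_add_one_sub fun i => θ (W.node i),
      Fin.sum_add_one_sub fun i => k (W.node i), map_zero, sub_zero]
  rw [Fintype.sum_eq_single j] at hsum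
  · exact sub_eq_zero.1 hsum
  · intro i hij
    exact sub_eq_zero.2 (hlB _ ((hWB i).resolve_left fun h => hij (W.toEdge_injective h)) _ _
      (W.isLink i))

end Graph

/-! ### Coordinates: flats are linear subspaces. -/

namespace ProjectiveGeometry

variable {P : Type u₁} (G : ProjectiveGeometry P) {F : Type u₂} {V : Type u₃} [DivisionRing F]
  [AddCommGroup V] [Module F V]

theorem line_eq_span {p q : P} (hpq : p ≠ q) : G.line p q = G.span {p, q} := by
  obtain ⟨L, hL, hp, hq⟩ := G.exists_line hpq
  ext x
  constructor
  · rintro ⟨M, hM, hpM, hqM, hx⟩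
    exact G.isSubspace_span _ p (G.subset_span _ (by simp)) q (G.subset_span _ (by simp)) hpq
      M hM hpM hqM hx
  · intro hx
    refine ⟨L, hL, hp, hq, G.span_subset (t := L) ?_ (by rintro _ (rfl | rfl) <;> assumption) hx⟩
    intro a ha b hb hab M hM haM hbM
    rw [G.eq_of_mem_lines hM hL hab haM hbM ha hb]

/-- `φ` identifies the lines of `G` with those of the projective space of `V`. -/
def IsCoordinatization (φ : P ≃ Projectivization F V) : Prop :=
  ∀ L : Set P, L ∈ G.lines ↔ ∃ W : Submodule F V, Module.finrank F W = 2 ∧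
    φ '' L = (W.projectivization : Set (Projectivization F V))

/-- `v` is a vector of homogeneous coordinates of the point `p`. -/
def IsVector (φ : P ≃ Projectivization F V) (p : P) (v : V) : Prop :=
  ∃ h : v ≠ 0, φ p = Projectivization.mk F v h

/-- The set of points that correspond to a subspace of `V`. -/
def flat (φ : P ≃ Projectivization F V) (K : Submodule F V) : Set P :=
  {p | φ p ∈ K.projectivization}

variable {φ : P ≃ Projectivization F V}

theorem isVector_rep (p : P) : IsVector φ p (φ p).rep :=
  ⟨Projectivization.rep_nonzero _, (Projectivization.mk_rep _).symm⟩

theorem isVector_symm {v : V} (hv : v ≠ 0) : IsVector φ (φ.symm (.mk F v hv)) v :=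
  ⟨hv, φ.apply_symm_apply _⟩

namespace IsVector

theorem mem_flat_iff {p : P} {v : V} (h : IsVector φ p v) (K : Submodule F V) :
    p ∈ flat φ K ↔ v ∈ K := by
  obtain ⟨hv, h⟩ := h
  rw [flat, mem_ofPred_eq, h, Submodule.mk_mem_projectivization_iff]

theorem eq_of_smul {p q : P} {v w : V} (hp : IsVector φ p v) (hq : IsVector φ q w) {c : F}
    (h : c • w = v) : p = q := by
  obtain ⟨hv, hp⟩ := hp
  obtain ⟨hw, hq⟩ := hq
  exact φ.injective (by rw [hp, hq, Projectivization.mk_eq_mk_iff']; exact ⟨c, h⟩)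

theorem smul {p : P} {v : V} (h : IsVector φ p v) {c : F} (hc : c ≠ 0) : IsVector φ p (c • v) := by
  obtain ⟨hv, h⟩ := h
  refine ⟨smul_ne_zero hc hv, ?_⟩
  rw [h, Projectivization.mk_eq_mk_iff']
  exact ⟨c⁻¹, inv_smul_smul₀ hc v⟩

theorem exists_smul_eq {p : P} {v w : V} (hv : IsVector φ p v) (hw : IsVector φ p w) :
    ∃ c : F, c • w = v := by
  obtain ⟨hv0, hv⟩ := hv
  obtain ⟨hw0, hw⟩ := hw
  exact (Projectivization.mk_eq_mk_iff' F _ _ hv0 hw0).1 (hv.symm.trans hw)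

end IsVector

theorem flat_subset_flat_iff {K H : Submodule F V} : flat φ K ⊆ flat φ H ↔ K ≤ H := by
  refine ⟨fun h v hv => ?_, fun h p hp => ?_⟩
  · by_cases hv0 : v = 0
    · exact hv0 ▸ H.zero_mem
    · have hp := isVector_symm (φ := φ) hv0
      exact (hp.mem_flat_iff H).1 (h ((hp.mem_flat_iff K).2 hv))
  · have hv := isVector_rep (φ := φ) p
    exact (hv.mem_flat_iff H).2 (h ((hv.mem_flat_iff K).1 hp))

variable {G}

namespace IsCoordinatization

variable (hφ : G.IsCoordinatization φ)

include hφ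

theorem isSubspace_flat (K : Submodule F V) : G.IsSubspace (flat φ K) := by
  intro p hp q hq hpq L hL hpL hqL x hx
  obtain ⟨W, hW, hWL⟩ := (hφ L).1 hL
  have hpv := isVector_rep (φ := φ) p
  have hqv := isVector_rep (φ := φ) q
  have hxv := isVector_rep (φ := φ) x
  have hmem : ∀ {y : P}, y ∈ L → y ∈ flat φ W := by
    intro y hy
    have : φ y ∈ φ '' L := mem_image_of_mem φ hy
    rw [hWL] at this
    exact this
  have hli := Projectivization.linearIndependent_pair_iff_ne.2 (φ.injective.ne hpq)
  have : FiniteDimensional F W := .of_finrank_pos (by omega)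
  have hspan : Submodule.span F (range ![(φ p).rep, (φ q).rep]) = W := by
    refine Submodule.eq_of_le_of_finrank_eq ?_ ?_
    · rw [Submodule.span_le, range_subset_iff]
      intro i
      fin_cases i
      exacts [(hpv.mem_flat_iff W).1 (hmem hpL), (hqv.mem_flat_iff W).1 (hmem hqL)]
    · rw [finrank_span_eq_card hli, hW, Fintype.card_fin]
  rw [hxv.mem_flat_iff]
  have hxW := (hxv.mem_flat_iff W).1 (hmem hx)
  rw [← hspan] at hxW
  refine Submodule.span_le.2 (range_subset_iff.2 fun i => ?_) hxW
  fin_cases i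
  exacts [(hpv.mem_flat_iff K).1 hp, (hqv.mem_flat_iff K).1 hq]

theorem exists_eq_flat {t : Set P} (ht : G.IsSubspace t) : ∃ K : Submodule F V, t = flat φ K := by
  let S : Projectivization.Subspace F V :=
    { carrier := φ '' t
      mem_add' := by
        rintro v w hv hw hvw ⟨p, hp, hpv⟩ ⟨q, hq, hqw⟩
        by_cases hpq : p = q
        · subst hpq
          obtain ⟨c, rfl⟩ := (Projectivization.mk_eq_mk_iff' F v w hv hw).1 (hpv.symm.trans hqw)
          refine ⟨p, hp, hqw.trans ?_⟩
          rw [Eq.comm, Projectivization.mk_eq_mk_iff']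
          exact ⟨c + 1, by rw [add_smul, one_smul]⟩
        · have hli := Projectivization.linearIndependent_pair_iff_ne.2 (φ.injective.ne hpq)
          set W := Submodule.span F (range ![(φ p).rep, (φ q).rep])
          have hpW : p ∈ flat φ W := ((isVector_rep p).mem_flat_iff W).2
            (Submodule.subset_span ⟨0, rfl⟩)
          have hqW : q ∈ flat φ W := ((isVector_rep q).mem_flat_iff W).2
            (Submodule.subset_span ⟨1, rfl⟩)
          have hL : flat φ W ∈ G.lines := (hφ _).2 ⟨W, by
            rw [finrank_span_eq_card hli, Fintype.card_fin],
            φ.surjective.image_preimage _⟩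
          refine ⟨φ.symm (.mk F (v + w) hvw), ht p hp q hq hpq _ hL hpW hqW ?_,
            φ.apply_symm_apply _⟩
          rw [(isVector_symm hvw).mem_flat_iff]
          exact W.add_mem ((IsVector.mem_flat_iff ⟨hv, hpv⟩ W).1 hpW)
            ((IsVector.mem_flat_iff ⟨hw, hqw⟩ W).1 hqW) }
  refine ⟨Projectivization.Subspace.submodule S, ?_⟩
  ext p
  rw [flat, mem_ofPred_eq, Submodule.projectivization, OrderIso.symm_apply_apply]
  exact (φ.injective.mem_set_image (s := t)).symm

theorem mem_span_iff {ι : Type*} {p : ι → P} {v : ι → V} (hv : ∀ i, IsVector φ (p i) (v i))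
    (S : Set ι) {x : P} {w : V} (hw : IsVector φ x w) :
    x ∈ G.span (p '' S) ↔ w ∈ Submodule.span F (v '' S) := by
  constructor
  · intro hx
    rw [← hw.mem_flat_iff]
    refine G.span_subset (hφ.isSubspace_flat _) ?_ hx
    rintro _ ⟨i, hi, rfl⟩
    exact ((hv i).mem_flat_iff _).2 (Submodule.subset_span ⟨i, hi, rfl⟩)
  · intro hx
    obtain ⟨K, hK⟩ := hφ.exists_eq_flat (G.isSubspace_span (p '' S))
    rw [hK, hw.mem_flat_iff]
    refine Submodule.span_le.2 ?_ hx
    rintro _ ⟨i, hi, rfl⟩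
    refine ((hv i).mem_flat_iff _).1 ?_
    rw [← hK]
    exact G.subset_span _ ⟨i, hi, rfl⟩

theorem mem_line_iff {p q x : P} {v w y : V} (hpq : p ≠ q) (hp : IsVector φ p v)
    (hq : IsVector φ q w) (hx : IsVector φ x y) :
    x ∈ G.line p q ↔ y ∈ Submodule.span F {v, w} := by
  have hv : ∀ i : Fin 2, IsVector φ (![p, q] i) (![v, w] i) := by
    intro i
    fin_cases i
    exacts [hp, hq]
  have h := hφ.mem_span_iff hv univ hx
  rw [image_univ, image_univ, Matrix.range_cons_cons_empty, Matrix.range_cons_cons_empty] at h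
  rw [G.line_eq_span hpq, h]

end IsCoordinatization

end ProjectiveGeometry

namespace OrthographicFrame

open ProjectiveGeometry

variable {α : Type u₁} {β : Type u₂} {Δ : Graph α β} {P : Type u₃} (D : OrthographicFrame Δ P)
  {F : Type u₄} {V : Type u₅} [DivisionRing F] [AddCommGroup V] [Module F V]
  {φ : P ≃ Projectivization F V} (hφ : D.geometry.IsCoordinatization φ)

include hφ

theorem circleFree_iff_linearIndepOn [Δ.Simple] {v : Δ.edgeSet → V}
    (hv : ∀ e, IsVector φ (D.z e) (v e)) (S : Set Δ.edgeSet) :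
    Δ.CircleFree (Subtype.val '' S) ↔ LinearIndepOn F v S := by
  rw [circleFree_iff, and_iff_right D.z_injective.injOn, linearIndepOn_iff_notMem_span]
  have hdiff : ∀ e, D.z '' (S \ {e}) = D.z '' S \ {D.z e} := fun e => by
    rw [image_sdiff D.z_injective, image_singleton]
  constructor
  · intro h e he hmem
    rw [← hφ.mem_span_iff hv _ (hv e), hdiff] at hmem
    exact h.notMem_span (mem_image_of_mem _ he) hmem
  · intro h T hT
    obtain ⟨_, ⟨e, he, rfl⟩, heT⟩ := exists_of_ssubset hT
    refine ⟨D.geometry.span_mono hT.1, fun hsub => h e he ?_⟩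
    rw [← hφ.mem_span_iff hv _ (hv e), hdiff]
    exact D.geometry.span_mono (subset_sdiff_singleton hT.1 heT)
      (hsub (D.geometry.subset_span _ (mem_image_of_mem _ he)))

/-- A projective representation of a graphic matroid is given by the differences of a vector-valued
function on the nodes. -/
theorem exists_potential [Δ.Simple] : ∃ θ : α → V, ∀ (e : Δ.edgeSet) u w, Δ.IsLink e u w →
    IsVector φ (D.z e) (θ w - θ u) := by
  obtain ⟨θ, hθ⟩ := Graph.exists_vector_potential
    (D.circleFree_iff_linearIndepOn hφ fun e => isVector_rep (D.z e))
  refine ⟨θ, fun e u w h => ?_⟩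
  obtain ⟨c, hc, h⟩ := hθ e u w h
  rw [h]
  exact (isVector_rep _).smul hc

end OrthographicFrame

namespace Graph.ClosedPath

variable {α : Type u₁} {β : Type u₂} {γ : Type u₃} {Γ : Graph α β} {Γ' : Graph α γ}

/-- The image of a closed path under an injection of edges that preserves the ends. -/
@[simps]
def map {n : ℕ} (W : Γ.ClosedPath n) (f : Γ.edgeSet → Γ'.edgeSet) (hf : Function.Injective f)
    (hlink : ∀ (e : Γ.edgeSet) u w, Γ.IsLink e u w → Γ'.IsLink (f e) u w) : Γ'.ClosedPath n where
  node := W.node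
  edge i := f (W.toEdge i)
  node_injective := W.node_injective
  edge_injective _ _ h := W.toEdge_injective (hf (Subtype.ext h))
  isLink i := hlink (W.toEdge i) _ _ (W.isLink i)

theorem range_edge_eq_iff {n : ℕ} (W : Γ.ClosedPath n) (C : Set Γ.edgeSet) :
    range W.edge = Subtype.val '' C ↔ range W.toEdge = C := by
  have : range W.edge = Subtype.val '' range W.toEdge := (range_comp Subtype.val W.toEdge)
  rw [this, Subtype.val_injective.image_injective.eq_iff]

end Graph.ClosedPath

/-! ### Affine parts, colorings and the group expansion. -/

namespace OrthographicFrame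

open ProjectiveGeometry

variable {α : Type u₁} {β : Type u₂} {Δ : Graph α β} {P : Type u₃} (D : OrthographicFrame Δ P)
  {F : Type u₄} {V : Type u₅} [DivisionRing F] [AddCommGroup V] [Module F V]
  {φ : P ≃ Projectivization F V}

section AffinePart

variable (hφ : D.geometry.IsCoordinatization φ) {θ : α → V}
  (hθ : ∀ (e : Δ.edgeSet) u w, Δ.IsLink e u w → IsVector φ (D.z e) (θ w - θ u))

include hφ hθ

theorem nonempty_coloring_of_isInAffinePart [Δ.Simple] (h : D.IsInAffinePart) :
    Nonempty (Δ.toSimpleGraph.Coloring F) := by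
  obtain ⟨s, ⟨hs, hsub, hmax⟩, hz⟩ := h
  obtain ⟨K, rfl⟩ := hφ.exists_eq_flat hs
  obtain ⟨H, hH⟩ := hφ.exists_eq_flat D.isHyperplane.1
  rw [hH] at hsub hmax hz
  have hKH := flat_subset_flat_iff.1 hsub.1
  obtain ⟨y, hyH, hyK⟩ := exists_of_ssubset hsub
  have hy := isVector_rep (φ := φ) y
  -- A form that vanishes on `K` but not at a vector of `H`. If it also vanished on an edge vector,
  -- which is not in `K`, it would vanish on all of `H` by maximality of the hyperplane.
  obtain ⟨l, hly, hl⟩ := Submodule.exists_le_ker_of_notMem (mt (hy.mem_flat_iff K).2 hyK)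
  have hne : ∀ (e : Δ.edgeSet) u w, Δ.IsLink e u w → l (θ w - θ u) ≠ 0 := by
    intro e u w he h0
    have hv := hθ e u w he
    set K' := K ⊔ Submodule.span F {θ w - θ u}
    have hvK' : θ w - θ u ∈ K' := Submodule.mem_sup_right (Submodule.mem_span_singleton_self _)
    have hK' : K' ≤ H := by
      refine sup_le hKH ((Submodule.span_singleton_le_iff_mem _ _).2 ?_)
      exact (hv.mem_flat_iff H).1 (hz e).1
    have heq := hmax (flat φ K') (hφ.isSubspace_flat K')
      ⟨flat_subset_flat_iff.2 le_sup_left, fun h =>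
        (hz e).2 (h ((hv.mem_flat_iff K').2 hvK'))⟩ (flat_subset_flat_iff.2 hK')
    rw [← heq, hy.mem_flat_iff] at hyH
    have hker : K' ≤ LinearMap.ker l :=
      sup_le hl ((Submodule.span_singleton_le_iff_mem _ _).2 h0)
    exact hly (hker hyH)
  refine ⟨SimpleGraph.Coloring.mk (fun u => l (θ u)) ?_⟩
  rintro u w huw heq
  obtain ⟨e, he⟩ := (Δ.toSimpleGraph_adj_iff u w).1 huw
  exact hne ⟨e, he.edge_mem⟩ u w he (by rw [map_sub, heq, sub_self])

theorem isInAffinePart_of_linearMap {l : V →ₗ[F] F} {H : Submodule F V} (hH : D.base = flat φ H)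
    {y : V} (hy : y ∈ H) (hly : l y ≠ 0)
    (hl : ∀ (e : Δ.edgeSet) u w, Δ.IsLink e u w → l (θ w - θ u) ≠ 0) : D.IsInAffinePart := by
  have hy0 : y ≠ 0 := fun h => hly (h ▸ map_zero l)
  have hyv := isVector_symm (φ := φ) hy0
  refine ⟨flat φ (H ⊓ LinearMap.ker l), ⟨hφ.isSubspace_flat _, ?_, fun s hs hsub hsb => ?_⟩,
    fun e => ⟨D.z_mem e, fun he => ?_⟩⟩
  · rw [hH]
    exact ⟨flat_subset_flat_iff.2 inf_le_left, fun h =>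
      hly ((flat_subset_flat_iff.1 h) hy).2⟩
  · obtain ⟨S, rfl⟩ := hφ.exists_eq_flat hs
    rw [hH] at hsb ⊢
    refine hsb.antisymm (flat_subset_flat_iff.2 fun b hb => ?_)
    obtain ⟨x, hxS, hx⟩ := exists_of_ssubset hsub
    have hxv := isVector_rep (φ := φ) x
    rw [hxv.mem_flat_iff] at hxS hx
    have hxH := flat_subset_flat_iff.1 hsb hxS
    have hlx : l (φ x).rep ≠ 0 := fun h => hx ⟨hxH, h⟩
    -- Any vector of `H` off the kernel of `l` generates `H` together with `H ⊓ ker l`; the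
    -- coefficient is chosen to cancel `l b`.
    have hmem : b - (l b * (l (φ x).rep)⁻¹) • (φ x).rep ∈ H ⊓ LinearMap.ker l := by
      refine ⟨H.sub_mem hb (H.smul_mem _ hxH), ?_⟩
      change l _ = 0
      rw [map_sub, map_smul, smul_eq_mul, inv_mul_cancel_right₀ hlx, sub_self]
    have := S.add_mem (flat_subset_flat_iff.1 hsub.1 hmem)
      (S.smul_mem (l b * (l (φ x).rep)⁻¹) hxS)
    rwa [sub_add_cancel] at this
  · obtain ⟨u, w, h⟩ := Graph.exists_isLink_of_mem_edgeSet e.2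
    exact hl e u w h (((hθ e u w h).mem_flat_iff _).1 he).2

theorem isInAffinePart_of_coloring [Δ.Simple] (hb : D.base.Nonempty)
    (k : Δ.toSimpleGraph.Coloring F) : D.IsInAffinePart := by
  classical
  obtain ⟨H, hH⟩ := hφ.exists_eq_flat D.isHyperplane.1
  obtain ⟨l, hl⟩ := Graph.exists_linearMap_of_potential
    (D.circleFree_iff_linearIndepOn hφ fun e => isVector_rep (D.z e))
    (fun e u w h => by
      have hv := hθ e u w h
      obtain ⟨c, hc⟩ := hv.exists_smul_eq (isVector_rep _)
      exact ⟨c, fun h0 => hv.1 (by rw [← hc, h0, zero_smul]), hc.symm⟩)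
    (fun x => if h : x ∈ Δ.vertexSet then k ⟨x, h⟩ else 0)
  have hl0 : ∀ (e : Δ.edgeSet) u w, Δ.IsLink e u w → l (θ w - θ u) ≠ 0 := by
    intro e u w h
    rw [hl e u w h, dif_pos h.left_mem, dif_pos h.right_mem, sub_ne_zero]
    exact (k.valid ((Δ.toSimpleGraph_adj_iff ⟨u, h.left_mem⟩ ⟨w, h.right_mem⟩).2 h.adj)).symm
  -- Without edges `l` may vanish on `H`; then any form that is nonzero at some point of the base
  -- serves.
  rcases isEmpty_or_nonempty Δ.edgeSet with hE | ⟨⟨e⟩⟩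
  · obtain ⟨p, hp⟩ := hb
    have hpv := isVector_rep (φ := φ) p
    obtain ⟨l', hl', -⟩ := Submodule.exists_le_ker_of_notMem (p := (⊥ : Submodule F V))
      (mt (Submodule.mem_bot F).1 hpv.1)
    exact D.isInAffinePart_of_linearMap hφ hθ hH ((hpv.mem_flat_iff H).1 (hH ▸ hp)) hl'
      fun e => hE.elim e
  · obtain ⟨u, w, h⟩ := Graph.exists_isLink_of_mem_edgeSet e.2
    exact D.isInAffinePart_of_linearMap hφ hθ hH
      (((hθ e u w h).mem_flat_iff H).1 (hH ▸ D.z_mem e)) (hl0 e u w h) hl0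

end AffinePart

section GroupExpansion

variable [Δ.Simple] (hφ : D.geometry.IsCoordinatization φ) {θ : α → V}
  (hθ : ∀ (e : Δ.edgeSet) u w, Δ.IsLink e u w → IsVector φ (D.z e) (θ w - θ u))
  {a : V} (ha : IsVector φ D.apex a) (O : Δ.Orientation)

include hθ ha

omit [Δ.Simple] in
theorem sub_ne_smul (e : Δ.edgeSet) (c : F) : θ (O.head e) - θ (O.tail e) ≠ c • a := fun h =>
  D.z_ne_apex e ((hθ e _ _ (O.isLink e)).eq_of_smul ha h.symm)

omit [Δ.Simple] in
theorem eq_of_isVector_add_smul {e : Δ.edgeSet} {x : P} {g g' : F}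
    (h : IsVector φ x (θ (O.head e) - θ (O.tail e) + g • a))
    (h' : IsVector φ x (θ (O.head e) - θ (O.tail e) + g' • a)) : g = g' := by
  obtain ⟨c, hc⟩ := h.exists_smul_eq h'
  have hc1 : c = 1 := by
    by_contra hne
    refine D.sub_ne_smul hθ ha O e ((1 - c)⁻¹ * (c * g' - g)) ?_
    rw [mul_smul, eq_inv_smul_iff₀ (sub_ne_zero.2 (Ne.symm hne))]
    rw [smul_add, smul_smul] at hc
    rw [sub_smul, sub_smul, one_smul, sub_eq_sub_iff_add_eq_add, add_comm (_ • a), hc]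
  subst hc1
  rw [one_smul, add_right_inj] at hc
  exact (smul_left_injective F ha.1 hc).symm

include hφ

omit [Δ.Simple] in
theorem mem_edgeLine_iff {e : Δ.edgeSet} {x : P} (hx : x ≠ D.apex) :
    x ∈ D.edgeLine e ↔ ∃ g : F, IsVector φ x (θ (O.head e) - θ (O.tail e) + g • a) := by
  have hz := hθ e _ _ (O.isLink e)
  constructor
  · intro h
    have hxv := isVector_rep (φ := φ) x
    rw [edgeLine, hφ.mem_line_iff (D.z_ne_apex e) hz ha hxv, Submodule.mem_span_pair] at h
    obtain ⟨b, c, h⟩ := h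
    have hb : b ≠ 0 := by
      rintro rfl
      rw [zero_smul, zero_add] at h
      exact hx (hxv.eq_of_smul ha h)
    refine ⟨b⁻¹ * c, ?_⟩
    have := hxv.smul (inv_ne_zero hb)
    rwa [← h, smul_add, inv_smul_smul₀ hb, smul_smul] at this
  · rintro ⟨g, hg⟩
    rw [edgeLine, hφ.mem_line_iff (D.z_ne_apex e) hz ha hg, Submodule.mem_span_pair]
    exact ⟨1, g, by rw [one_smul]⟩

-- The sign rule for gains is applied to vector labels in `V`: reversal of an edge negates both `θ
-- head - θ tail` and `g`.
omit [Δ.Simple] hφ hθ ha in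
theorem gain_add_smul (e : Δ.edgeSet) (g : F) {u w : α} (h : Δ.IsLink e u w) :
    O.gain (θ (O.head e) - θ (O.tail e) + g • a, e) u = (θ w - θ u) + O.gain (g, e) u • a := by
  have hO := O.isLink e
  simp only [Graph.Orientation.gain]
  split_ifs with ht
  · rw [ht] at hO ⊢
    rw [hO.right_unique h]
  · rcases h.eq_and_eq_or_eq_and_eq hO with ⟨h1, -⟩ | ⟨h1, h2⟩
    · exact absurd h1.symm ht
    · rw [h1, h2, neg_add, neg_sub, neg_smul]

omit hθ in
/-- A circle is balanced if and only if its total gain is zero. -/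
theorem apex_notMem_span_iff {n : ℕ} (W : D.fullOmega.graph.ClosedPath n) (g : Fin (n + 2) → F)
    (hg : ∀ i, IsVector φ (W.edge i) (θ (O.head (D.fullOmega.proj (W.toEdge i))) -
      θ (O.tail (D.fullOmega.proj (W.toEdge i))) + g i • a)) :
    D.apex ∉ D.geometry.span (range W.edge) ↔
      ∑ i, O.gain (g i, D.fullOmega.proj (W.toEdge i)) (W.node i) = 0 := by
  set y : Fin (n + 2) → V := fun i => θ (O.head (D.fullOmega.proj (W.toEdge i))) -
      θ (O.tail (D.fullOmega.proj (W.toEdge i))) + g i • a with hy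
  -- The vectors are signed according to the traversal, so that their potential parts telescope; the
  -- signs do not affect spans.
  set y' : Fin (n + 2) → V := fun i => O.gain (y i, D.fullOmega.proj (W.toEdge i)) (W.node i)
  have hy' : ∀ i, y' i = y i ∨ y' i = - y i := by
    intro i
    simp only [y', Graph.Orientation.gain]
    split_ifs
    exacts [Or.inl rfl, Or.inr rfl]
  have hmem : ∀ (N : Submodule F V) i, y' i ∈ N ↔ y i ∈ N := by
    intro N i
    rcases hy' i with h | h <;> rw [h]
    rw [N.neg_mem_iff]
  have hsum : ∑ i, y' i =
      (∑ i, O.gain (g i, D.fullOmega.proj (W.toEdge i)) (W.node i)) • a := by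
    have : ∀ i, y' i = (θ (W.node (i + 1)) - θ (W.node i)) +
        O.gain (g i, D.fullOmega.proj (W.toEdge i)) (W.node i) • a := fun i =>
      gain_add_smul O _ _ (D.isLink_proj (x := W.toEdge i) (W.isLink i))
    rw [Finset.sum_congr rfl fun i _ => this i, Finset.sum_add_distrib,
      Fin.sum_add_one_sub fun i => θ (W.node i), zero_add, Finset.sum_smul]
  constructor
  · intro hat
    by_contra hne
    refine hat ?_
    rw [← image_univ, hφ.mem_span_iff hg univ ha]
    have hin : ∑ i, y' i ∈ Submodule.span F (y '' univ) :=
      Submodule.sum_mem _ fun i _ => (hmem _ i).2 (Submodule.subset_span ⟨i, mem_univ i, rfl⟩)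
    rw [hsum] at hin
    exact ((Submodule.span F (y '' univ)).smul_mem_iff hne).1 hin
  · intro h0 hat
    rw [h0, zero_smul] at hsum
    -- With gain zero, the vector of edge 0 is, up to sign, minus the sum of the other signed
    -- vectors. So the circle spans no more than a circle-free set does.
    have hT : W.edge '' {0}ᶜ = range W.edge \ {W.edge 0} := by
      rw [compl_eq_univ_sdiff, image_sdiff W.edge_injective, image_univ, image_singleton]
    have hWE : range W.edge ⊆ D.fullOmega.graph.edgeSet := range_subset_iff.2 W.edge_mem
    refine D.apex_notMem_span ((finite_range W.edge).subset sdiff_subset)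
      (sdiff_subset.trans hWE) (W.circleFree_diff_edge 0)
      (D.geometry.span_subset_span ?_ hat)
    rintro _ ⟨i, rfl⟩
    by_cases hi : i = 0
    · rw [← hT, hi, hφ.mem_span_iff hg _ (hg 0), ← hmem]
      rw [Fin.sum_univ_succ] at hsum
      rw [eq_neg_of_add_eq_zero_left hsum]
      refine Submodule.neg_mem _ (Submodule.sum_mem _ fun j _ => (hmem _ _).2 ?_)
      exact Submodule.subset_span ⟨j.succ, Fin.succ_ne_zero j, rfl⟩
    · exact D.geometry.subset_span _ ⟨mem_range_self i, fun h => hi (W.edge_injective h)⟩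

theorem stablyIsomorphic_groupExpansion :
    D.fullOmega.StablyIsomorphic (Graph.groupExpansion O F) := by
  have hex : ∀ x : D.fullOmega.graph.edgeSet, ∃ g : F, IsVector φ (x : P)
      (θ (O.head (D.fullOmega.proj x)) - θ (O.tail (D.fullOmega.proj x)) + g • a) := fun x =>
    (D.mem_edgeLine_iff hφ hθ ha O x.2.2).1 (D.mem_edgeLine_proj x)
  choose g hg using hex
  have hmem : ∀ x : F × Δ.edgeSet, x ∈ (Graph.groupExpansion O F).graph.edgeSet := fun x =>
    (Graph.IsLink.edge_mem (G := Δ.expansionGraph F) (e := x) (O.isLink x.2))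
  let f : D.fullOmega.graph.edgeSet → (Graph.groupExpansion O F).graph.edgeSet := fun x =>
    ⟨(g x, D.fullOmega.proj x), hmem _⟩
  have hf : Function.Bijective f := by
    constructor
    · intro x y hxy
      have h := congrArg Subtype.val hxy
      have h1 : g x = g y := congrArg Prod.fst h
      have h2 : D.fullOmega.proj x = D.fullOmega.proj y := congrArg Prod.snd h
      refine Subtype.ext ((hg x).eq_of_smul (hg y) (c := 1) ?_)
      rw [one_smul, h1, h2]
    · rintro ⟨⟨c, e⟩, -⟩
      have hne : θ (O.head e) - θ (O.tail e) + c • a ≠ 0 := fun h =>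
        D.sub_ne_smul hθ ha O e (-c) (by rw [neg_smul, eq_neg_of_add_eq_zero_left h])
      have hv := isVector_symm (φ := φ) hne
      have hxa : φ.symm (.mk F _ hne) ≠ D.apex := by
        intro h
        rw [h] at hv
        obtain ⟨b, hb⟩ := hv.exists_smul_eq ha
        exact D.sub_ne_smul hθ ha O e (b - c) (by rw [sub_smul, hb, add_sub_cancel_right])
      have hxe := (D.mem_edgeLine_iff hφ hθ ha O hxa).2 ⟨c, hv⟩
      let x : D.fullOmega.graph.edgeSet := ⟨_, D.mem_edgeSet_iff.2 ⟨⟨e, hxe⟩, hxa⟩⟩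
      have hpe : D.fullOmega.proj x = e := (D.proj_eq_iff x e).2 hxe
      refine ⟨x, Subtype.ext (Prod.ext ?_ hpe)⟩
      have hgx := hg x
      rw [hpe] at hgx
      exact D.eq_of_isVector_add_smul hθ ha O hgx hv
  have hlink : ∀ (x : D.fullOmega.graph.edgeSet) u v, D.fullOmega.graph.IsLink x u v ↔
      (Graph.groupExpansion O F).graph.IsLink (f x) u v := fun x u v =>
    ⟨fun h => D.isLink_proj h, fun h => D.fullOmega_isLink_iff.2
      ⟨_, ⟨D.mem_edgeLine_proj x, x.2.2⟩, h⟩⟩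
  refine ⟨rfl, Equiv.ofBijective f hf, hlink, fun x => rfl, fun C => ?_⟩
  have key : ∀ {n : ℕ} (W : D.fullOmega.graph.ClosedPath n),
      D.apex ∉ D.geometry.span (range W.edge) ↔
        ∑ i, O.gain (f (W.toEdge i)).val (W.node i) = 0 := fun W =>
    D.apex_notMem_span_iff hφ ha O W (fun i => g (W.toEdge i)) fun i => hg (W.toEdge i)
  constructor
  · rintro ⟨⟨n, (W : D.fullOmega.graph.ClosedPath n), hW⟩, hat⟩
    have hW : range W.edge = Subtype.val '' C := hW
    refine ⟨n, W.map f hf.1 fun e u w h => (hlink e u w).1 h, ?_, ?_⟩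
    · refine (Graph.ClosedPath.range_edge_eq_iff _ _).2 ?_
      rw [← (W.range_edge_eq_iff C).1 hW]
      exact range_comp f W.toEdge
    · rw [← hW] at hat
      exact (key W).1 hat
  · rintro ⟨n, (W' : (Graph.groupExpansion O F).graph.ClosedPath n), hW', h0⟩
    set ψ := Equiv.ofBijective f hf
    have hψf : ∀ y, f (ψ.symm y) = y := ψ.apply_symm_apply
    let W : D.fullOmega.graph.ClosedPath n := W'.map ψ.symm ψ.symm.injective
      fun e u w h => (hlink _ u w).2 (by rw [hψf]; exact h)
    have hW : range W.edge = Subtype.val '' C := by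
      have hW' : range W'.toEdge = ψ '' C := (W'.range_edge_eq_iff _).1 hW'
      have : range W.toEdge = ψ.symm '' range W'.toEdge := range_comp ψ.symm W'.toEdge
      rw [Graph.ClosedPath.range_edge_eq_iff, this, hW', ψ.symm_image_image]
    refine ⟨⟨n, W, hW⟩, ?_⟩
    rw [← hW, key]
    have : ∀ i, f (W.toEdge i) = W'.toEdge i := fun i => hψf _
    simp only [this]
    exact h0

end GroupExpansion

end OrthographicFrame

theorem mainTheorem11 {α : Type u₁} {β : Type u₂} {P : Type u₃} (Δ : Graph α β) [Δ.Simple]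
    (D : OrthographicFrame Δ P) :
    D.fullOmega.IsBiasedExpansion ∧
    ∀ (F : Type u₄) (V : Type u₅) [DivisionRing F] [AddCommGroup V] [Module F V],
      D.geometry.HasCoordinates F V →
        (Δ.vertexSet.Finite → D.base.Nonempty →
          (D.IsInAffinePart ↔ Nonempty (Δ.toSimpleGraph.Coloring F))) ∧
        (D.IsInAffinePart ∨ Nonempty (Δ.toSimpleGraph.Coloring F) →
          ∀ O : Δ.Orientation, D.fullOmega.StablyIsomorphic (Graph.groupExpansion O F)) := by
  refine ⟨D.isBiasedExpansion_fullOmega, fun F V _ _ _ ⟨φ, hφ⟩ => ?_⟩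
  obtain ⟨θ, hθ⟩ := D.exists_potential hφ
  exact ⟨fun _ hb => ⟨D.nonempty_coloring_of_isInAffinePart hφ hθ,
      fun ⟨k⟩ => D.isInAffinePart_of_coloring hφ hθ hb k⟩,
    fun _ O => D.stablyIsomorphic_groupExpansion hφ hθ
      (ProjectiveGeometry.isVector_rep D.apex) O⟩
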